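/- Let $\hbar>0$, let $A\cup B$ be a bipartite system with $n_A$ and $n_B$ degrees of freedom, $n=n_A+n_B$, and write phase space points as $z=(z_A,z_B)$, $z_A=(x_A,p_A)$, $z_B=(x_B,p_B)$, $x=(x_A,x_B)$, $p=(p_A,p_B)$. Let $H(z,t)$ be a real Hamiltonian function on $\mathbb{R}^{2n}\times\mathbb{R}$, twice continuously differentiable in $z$ and once continuously differentiable in $t$, and let $\Phi_t$ be its flow, $\Phi_0(z)=z$, $\frac{d}{dt}\Phi_t(z)=J\nabla_zH(\Phi_t(z),t)$, with $J=\begin{pmatrix}0&I\\-I&0\end{pmatrix}$ in the coordinates $(x,p)$, defined for $t$ in an interval $I\ni 0$ and for initial points in a neighborhood of $z_0=(x_0,p_0)$ (for instance globally). Let $z_t=\Phi_t(z_0)$ be the reference orbit, with $A$-component $z_{A,t}$, and let $S_t=S_t(z_0)$ be the (symplectic) Jacobian matrix of $\Phi_t$ at $z_0$. Let $\widehat T(z_0)\psi(x)=e^{\frac{i}{\hbar}(p_0\cdot x-\frac12p_0\cdot x_0)}\psi(x-x_0)$ be the displacement operators on $L^2(\mathbb{R}^n)$, and let $\widehat S_t$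 be the metaplectic lift of $t\mapsto S_t$: the (strongly) continuous path of operators $\widehat S_t\in\mathrm{Mp}(n)$ projecting onto $S_t\in\mathrm{Sp}(n)$, with $\widehat S_0$ the identity. For an arbitrary real phase $\gamma(t)$ let $$\widehat U_t=e^{\frac{i}{\hbar}\gamma(t)}\,\widehat T(z_t)\,\widehat S_t\,\widehat T(-z_0)$$ be the semiclassical (nearby-orbit, generalized thawed Gaussian) propagator. Assume that at time $0$ the system is in the coherent state $\phi_{z_0}(x)=(\pi\hbar)^{-n/4}e^{\frac{i}{\hbar}p_0\cdot x}e^{-|x-x_0|^2/2\hbar}$, and that its state at time $t\in I$ is $\psi_t=\widehat U_t\phi_{z_0}$. Put $P_t=(S_tS_t^T)^{-1}$, written in blocks $P_{AA,t},P_{AB,t},P_{BA,t},P_{BB,t}$ with respect to $z=(z_A,z_B)$, and $$M_{A,t}=P_t/P_{BB,t}=P_{AA,t}-P_{AB,t}P_{BB,t}^{-1}P_{BA,t}.$$ Then, for every $t\in I$, $P_{BB,t}$ and $M_{A,t}$ are symmetric positive definite, and the subsystem $A$ is in a Gaussian (in general mixed) state: the partial trace $\widehat\rho_{A,t}=\mathrm{Tr}_B|\psi_t\rangle\langle\psi_t|$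 is a density operator on $L^2(\mathbb{R}^{n_A})$ (a positive operator of trace one) whose Wigner distribution (the Wigner transform $(2\pi\hbar)^{-n_A}\int e^{-\frac{i}{\hbar}p_A\cdot y}K(x_A+\frac12y,x_A-\frac12y)\,dy$ of its integral kernel $K$) is $$\rho_{A,t}(z_A)=(\pi\hbar)^{-n_A}(\det M_{A,t})^{1/2}\,e^{-\frac1\hbar M_{A,t}(z_A-z_{A,t})\cdot(z_A-z_{A,t})}.$$ For every $z_A$ this is equal to the (absolutely convergent) integral $\int_{\mathbb{R}^{2n_B}}W\psi_t(z_A,z_B)\,dz_B$, where $W\psi(x,p)=(2\pi\hbar)^{-n}\int_{\mathbb{R}^n}e^{-\frac{i}{\hbar}p\cdot y}\psi(x+\frac12y)\overline{\psi(x-\frac12y)}\,dy$ is the Wigner transform. The purity of $\widehat\rho_{A,t}$ is $$\mu(\widehat\rho_{A,t})=\mathrm{Tr}(\widehat\rho_{A,t}^{\,2})=\frac{1}{\sqrt{\det P_{BB,t}}}.$$ -/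

import Mathlib

open MeasureTheory Matrix
open scoped ComplexConjugate InnerProductSpace

namespace ThawedGaussian

/-! ### Phase space and Hamiltonian mechanics

The configuration space with index set `ι` is `ι → ℝ`; the phase space is `ι ⊕ ι → ℝ`,
a phase space point `z` having position part `z ∘ Sum.inl` and momentum part `z ∘ Sum.inr`. -/

/-- Phase space of a system with degrees of freedom indexed by `ι`. -/
abbrev Phase (ι : Type) : Type := ι ⊕ ι → ℝ

/-- Position part of a phase space point. -/
def pos {ι : Type} (z : Phase ι) : ι → ℝ := fun i => z (Sum.inl i)

/-- Momentum part of a phase space point. -/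
def mom {ι : Type} (z : Phase ι) : ι → ℝ := fun i => z (Sum.inr i)

/-- The standard symplectic matrix, with blocks `0, 1, -1, 0`. -/
def stdJ (ι : Type) [DecidableEq ι] : Matrix (ι ⊕ ι) (ι ⊕ ι) ℝ :=
  Matrix.fromBlocks 0 1 (-1) 0

/-- Gradient of a function on phase space (column of partial derivatives). -/
noncomputable def grad {ι : Type} [Fintype ι] [DecidableEq ι] (H : Phase ι → ℝ) (z : Phase ι) :
    Phase ι :=
  fun i => fderiv ℝ H z (Pi.single i 1)

/-- `Φ` is the flow of the time-dependent Hamiltonian `H`, for times in `I` and initial points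
in `U`: `Φ 0 z = z` and `d/dt Φ t z = J ∇H(Φ t z, t)`. -/
structure IsHamiltonianFlowOn {ι : Type} [Fintype ι] [DecidableEq ι] (H : ℝ → Phase ι → ℝ)
    (I : Set ℝ) (U : Set (Phase ι)) (Φ : ℝ → Phase ι → Phase ι) : Prop where
  init : ∀ z ∈ U, Φ 0 z = z
  hamilton : ∀ z ∈ U, ∀ t ∈ I,
    HasDerivWithinAt (fun s => Φ s z) (stdJ ι *ᵥ grad (H t) (Φ t z)) I t

/-- The Jacobian matrix `∂z_t/∂z_0` of the flow map at time `t`, at the point `z₀`. -/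
noncomputable def flowJacobian {ι : Type} [Fintype ι] [DecidableEq ι]
    (Φ : ℝ → Phase ι → Phase ι) (z₀ : Phase ι) (t : ℝ) : Matrix (ι ⊕ ι) (ι ⊕ ι) ℝ :=
  Matrix.of fun i j => fderiv ℝ (Φ t) z₀ (Pi.single j 1) i

/-! ### Wave functions, displacement operators, metaplectic operators -/

/-- The Hilbert space of square integrable functions on the configuration space `ι → ℝ`. -/
abbrev L2 (ι : Type) [Fintype ι] : Type := Lp ℂ 2 (volume : Measure (ι → ℝ))

/-- The unimodular factor of the displacement operator. -/
noncomputable def displacementPhase {ι : Type} [Fintype ι] (ħ : ℝ) (z : Phase ι) (x : ι → ℝ) : ℂ :=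
  Complex.exp (Complex.I * ((mom z ⬝ᵥ x - (mom z ⬝ᵥ pos z) / 2 : ℝ) : ℂ) / (ħ : ℂ))

theorem norm_displacementPhase {ι : Type} [Fintype ι] (ħ : ℝ) (z : Phase ι) (x : ι → ℝ) :
    ‖displacementPhase ħ z x‖ = 1 := by
  unfold displacementPhase
  rw [mul_div_assoc, ← Complex.ofReal_div, mul_comm]
  exact Complex.norm_exp_ofReal_mul_I _

theorem memLp_displacement {ι : Type} [Fintype ι] (ħ : ℝ) (z : Phase ι) (ψ : L2 ι) :
    MemLp (fun x : ι → ℝ => displacementPhase ħ z x * ψ (x - pos z)) 2 volume := by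
  have h : MemLp (fun x : ι → ℝ => ψ (x - pos z)) 2 volume :=
    (Lp.memLp ψ).comp_measurePreserving (measurePreserving_sub_right volume (pos z))
  have hc : Continuous (displacementPhase ħ z) := by
    unfold displacementPhase dotProduct
    fun_prop
  refine h.of_le (hc.aestronglyMeasurable.mul h.1) (Filter.Eventually.of_forall fun x => ?_)
  rw [norm_mul, norm_displacementPhase, one_mul]

/-- The Heisenberg displacement operator
`(T̂(z₀) ψ)(x) = exp(i (p₀ · x - p₀ · x₀ / 2) / ħ) ψ(x - x₀)` on `L²`. -/
noncomputable def displacement {ι : Type} [Fintype ι] (ħ : ℝ) (z : Phase ι) (ψ : L2 ι) : L2 ι :=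
  (memLp_displacement ħ z ψ).toLp _

/-- `IsMetaplectic ħ Ŝ S` : the unitary operator `Ŝ` belongs to the metaplectic group and its
projection on the symplectic group is `S`. The metaplectic group is generated by the Fourier
transform, the multiplications by quadratic chirps, and the unitary rescalings with their
Maslov factors; the projection is the group homomorphism given on these generators. -/
inductive IsMetaplectic {ι : Type} [Fintype ι] [DecidableEq ι] (ħ : ℝ) :
    (L2 ι ≃ₗᵢ[ℂ] L2 ι) → Matrix (ι ⊕ ι) (ι ⊕ ι) ℝ → Prop
  /-- `(Ĵ ψ)(x) = (2 π i ħ)^(-n/2) ∫ exp(-i x · y / ħ) ψ(y) dy`, projecting to `J`. -/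
  | fourier (F : L2 ι ≃ₗᵢ[ℂ] L2 ι)
      (hF : ∀ ψ : L2 ι, Integrable (ψ : (ι → ℝ) → ℂ) volume →
        (F ψ : (ι → ℝ) → ℂ) =ᵐ[volume] fun x =>
          (((2 * Real.pi * ħ) ^ (-(Fintype.card ι : ℝ) / 2) : ℝ) : ℂ)
            * Complex.exp (-(Complex.I * (Fintype.card ι : ℂ) * (Real.pi : ℂ) / 4))
            * ∫ y : ι → ℝ, Complex.exp (-(Complex.I * ((x ⬝ᵥ y : ℝ) : ℂ) / (ħ : ℂ))) * ψ y) :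
      IsMetaplectic ħ F (stdJ ι)
  /-- `(V̂ ψ)(x) = exp(i P x · x / (2 ħ)) ψ(x)` with `P` symmetric. -/
  | chirp (P : Matrix ι ι ℝ) (hP : P.IsSymm) (V : L2 ι ≃ₗᵢ[ℂ] L2 ι)
      (hV : ∀ ψ : L2 ι, (V ψ : (ι → ℝ) → ℂ) =ᵐ[volume] fun x =>
        Complex.exp (Complex.I * (((P *ᵥ x) ⬝ᵥ x : ℝ) : ℂ) / (2 * (ħ : ℂ))) * ψ x) :
      IsMetaplectic ħ V (Matrix.fromBlocks 1 0 P 1)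
  /-- `(M̂ ψ)(x) = i^m |det L|^(1/2) ψ(L x)`, where `m π` is an argument of `det L`. -/
  | scaling (L : Matrix ι ι ℝ) (hL : L.det ≠ 0) (m : ℕ) (hm : Even m ↔ 0 < L.det)
      (V : L2 ι ≃ₗᵢ[ℂ] L2 ι)
      (hV : ∀ ψ : L2 ι, (V ψ : (ι → ℝ) → ℂ) =ᵐ[volume] fun x =>
        Complex.I ^ m * ((Real.sqrt |L.det| : ℝ) : ℂ) * ψ (L *ᵥ x)) :
      IsMetaplectic ħ V (Matrix.fromBlocks L⁻¹ 0 0 Lᵀ)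
  | mul (V W : L2 ι ≃ₗᵢ[ℂ] L2 ι) (S R : Matrix (ι ⊕ ι) (ι ⊕ ι) ℝ)
      (hV : IsMetaplectic ħ V S) (hW : IsMetaplectic ħ W R) :
      IsMetaplectic ħ (W.trans V) (S * R)
  | inv (V : L2 ι ≃ₗᵢ[ℂ] L2 ι) (S : Matrix (ι ⊕ ι) (ι ⊕ ι) ℝ) (hV : IsMetaplectic ħ V S) :
      IsMetaplectic ħ V.symm S⁻¹

/-- `Ŝ` is the metaplectic lift, on the time interval `I`, of the path of matrices `S`:
the (strongly) continuous path of metaplectic operators above `S` that starts at the identity. -/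
structure IsMetaplecticLift {ι : Type} [Fintype ι] [DecidableEq ι] (ħ : ℝ) (I : Set ℝ)
    (S : ℝ → Matrix (ι ⊕ ι) (ι ⊕ ι) ℝ) (Shat : ℝ → (L2 ι ≃ₗᵢ[ℂ] L2 ι)) : Prop where
  init : Shat 0 = LinearIsometryEquiv.refl ℂ (L2 ι)
  lift : ∀ t ∈ I, IsMetaplectic ħ (Shat t) (S t)
  cont : ∀ ψ : L2 ι, ContinuousOn (fun t => Shat t ψ) I

/-- The semiclassical propagator `exp(i γ / ħ) T̂(z_t) Ŝ T̂(-z₀)`. -/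
noncomputable def semiclassicalPropagator {ι : Type} [Fintype ι] (ħ γ : ℝ) (zt z₀ : Phase ι)
    (Shat : L2 ι ≃ₗᵢ[ℂ] L2 ι) (ψ : L2 ι) : L2 ι :=
  Complex.exp (Complex.I * (γ : ℂ) / (ħ : ℂ)) •
    displacement ħ zt (Shat (displacement ħ (-z₀) ψ))

/-- The coherent state
`φ_{z₀}(x) = (π ħ)^(-n/4) exp(i p₀ · x / ħ) exp(-|x - x₀|² / (2 ħ))`, as a function. -/
noncomputable def coherentFun {ι : Type} [Fintype ι] (ħ : ℝ) (z₀ : Phase ι) (x : ι → ℝ) : ℂ :=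
  (((Real.pi * ħ) ^ (-(Fintype.card ι : ℝ) / 4) : ℝ) : ℂ)
    * Complex.exp (Complex.I * ((mom z₀ ⬝ᵥ x : ℝ) : ℂ) / (ħ : ℂ))
    * ((Real.exp (-((x - pos z₀) ⬝ᵥ (x - pos z₀)) / (2 * ħ)) : ℝ) : ℂ)

theorem memLp_coherentFun {ι : Type} [Fintype ι] {ħ : ℝ} (hħ : 0 < ħ) (z₀ : Phase ι) :
    MemLp (coherentFun ħ z₀) 2 volume := by
  have hc : Continuous (coherentFun ħ z₀) := by
    unfold coherentFun dotProduct
    fun_prop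
  rw [memLp_two_iff_integrable_sq_norm hc.aestronglyMeasurable]
  have hb : (0 : ℝ) < 1 / ħ := by positivity
  have h1 : Integrable (fun x : ι → ℝ => ∏ i, Real.exp (-(1 / ħ) * (x i) ^ 2)) volume :=
    Integrable.fintype_prod (f := fun (_ : ι) (v : ℝ) => Real.exp (-(1 / ħ) * v ^ 2))
      (fun _ => integrable_exp_neg_mul_sq hb)
  have h2 := (h1.comp_sub_right (pos z₀)).const_mul
    (((Real.pi * ħ) ^ (-(Fintype.card ι : ℝ) / 4)) ^ 2)
  refine h2.congr (Filter.Eventually.of_forall fun x => ?_)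
  have h3 : ‖Complex.exp (Complex.I * ((mom z₀ ⬝ᵥ x : ℝ) : ℂ) / (ħ : ℂ))‖ = 1 := by
    rw [mul_div_assoc, ← Complex.ofReal_div, mul_comm]
    exact Complex.norm_exp_ofReal_mul_I _
  simp only [coherentFun, norm_mul, h3, Complex.norm_real, mul_one, mul_pow, Real.norm_eq_abs,
    sq_abs]
  rw [← Real.exp_sum, ← Real.exp_nat_mul]
  congr 2
  simp only [dotProduct, Pi.sub_apply, ← Finset.mul_sum]
  have h4 : ħ ≠ 0 := hħ.ne'
  simp only [pow_two]
  push_cast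
  field_simp

/-- The coherent state `φ_{z₀}` as an element of `L²`. -/
noncomputable def coherentState {ι : Type} [Fintype ι] {ħ : ℝ} (hħ : 0 < ħ) (z₀ : Phase ι) :
    L2 ι :=
  (memLp_coherentFun hħ z₀).toLp _

/-! ### Wigner transforms, density operators -/

/-- The Wigner transform of a kernel `K(x, x')`:
`(2 π ħ)^(-n) ∫ exp(-i p · y / ħ) K(x + y/2, x - y/2) dy`. -/
noncomputable def wignerKernel {ι : Type} [Fintype ι] (ħ : ℝ) (K : (ι → ℝ) → (ι → ℝ) → ℂ)
    (z : Phase ι) : ℂ :=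
  ((((2 * Real.pi * ħ) ^ (Fintype.card ι))⁻¹ : ℝ) : ℂ) *
    ∫ y : ι → ℝ, Complex.exp (-(Complex.I * ((mom z ⬝ᵥ y : ℝ) : ℂ) / (ħ : ℂ))) *
      K (pos z + (1 / 2 : ℝ) • y) (pos z - (1 / 2 : ℝ) • y)

/-- The Wigner transform of a wave function. -/
noncomputable def wigner {ι : Type} [Fintype ι] (ħ : ℝ) (ψ : L2 ι) (z : Phase ι) : ℂ :=
  wignerKernel ħ (fun x y => ψ x * conj (ψ y)) z

/-- The operator `T` on `L²` has the square integrable integral kernel `K`. -/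
structure HasKernel {ι : Type} [Fintype ι] (T : L2 ι →L[ℂ] L2 ι) (K : (ι → ℝ) → (ι → ℝ) → ℂ) :
    Prop where
  memLp : MemLp (fun q : (ι → ℝ) × (ι → ℝ) => K q.1 q.2) 2 (volume.prod volume)
  apply : ∀ f : L2 ι, (T f : (ι → ℝ) → ℂ) =ᵐ[volume] fun x => ∫ y : ι → ℝ, K x y * f y

/-- The function `w` on phase space is the Wigner distribution of the operator `T`: it is
(almost everywhere) the Wigner transform of the integral kernel of `T`. -/
def IsWignerDistribution {ι : Type} [Fintype ι] (ħ : ℝ) (T : L2 ι →L[ℂ] L2 ι)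
    (w : Phase ι → ℝ) : Prop :=
  ∃ K : (ι → ℝ) → (ι → ℝ) → ℂ, HasKernel T K ∧
    ∀ᵐ z : Phase ι, wignerKernel ħ K z = (w z : ℂ)

/-- `c` is the trace of `T`: the sum of the diagonal matrix elements converges
(unconditionally) to `c` in every Hilbert basis. -/
def IsTrace {ι : Type} [Fintype ι] (T : L2 ι →L[ℂ] L2 ι) (c : ℂ) : Prop :=
  ∀ (κ : Type) (b : HilbertBasis κ ℂ (L2 ι)), HasSum (fun k => ⟪b k, T (b k)⟫_ℂ) c

/-- Density operators: positive operators with trace one. -/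
structure IsDensityOperator {ι : Type} [Fintype ι] (T : L2 ι →L[ℂ] L2 ι) : Prop where
  positive : T.IsPositive
  trace_one : IsTrace T 1

/-- `μ` is the purity `Tr(T²)` of the state `T`. -/
def HasPurity {ι : Type} [Fintype ι] (T : L2 ι →L[ℂ] L2 ι) (μ : ℝ) : Prop :=
  IsTrace (T ∘L T) (μ : ℂ)

/-! ### Bipartite systems -/

/-- The `A`-component `z_A = (x_A, p_A)` of a phase space point of the system `A ∪ B`. -/
def projA {α β : Type} (z : Phase (α ⊕ β)) : Phase α :=
  Sum.elim (fun a => z (Sum.inl (Sum.inl a))) (fun a => z (Sum.inr (Sum.inl a)))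

/-- The phase space point of `A ∪ B` with components `z_A` and `z_B`. -/
def joinAB {α β : Type} (zA : Phase α) (zB : Phase β) : Phase (α ⊕ β) :=
  Sum.elim (Sum.elim (pos zA) (pos zB)) (Sum.elim (mom zA) (mom zB))

/-- Rewriting of a matrix on the phase space of `A ∪ B`, in the ordering
`z = (x_A, p_A, x_B, p_B)` of the coordinates. -/
def bipartite {α β : Type} (P : Matrix ((α ⊕ β) ⊕ (α ⊕ β)) ((α ⊕ β) ⊕ (α ⊕ β)) ℝ) :
    Matrix ((α ⊕ α) ⊕ (β ⊕ β)) ((α ⊕ α) ⊕ (β ⊕ β)) ℝ :=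
  P.submatrix (Equiv.sumSumSumComm α α β β) (Equiv.sumSumSumComm α α β β)

/-- The block `P_BB`. -/
def blockBB {α β : Type} (P : Matrix ((α ⊕ β) ⊕ (α ⊕ β)) ((α ⊕ β) ⊕ (α ⊕ β)) ℝ) :
    Matrix (β ⊕ β) (β ⊕ β) ℝ :=
  (bipartite P).toBlocks₂₂

/-- The Schur complement `P / P_BB = P_AA - P_AB P_BB⁻¹ P_BA`. -/
noncomputable def schurA {α β : Type} [Fintype β] [DecidableEq β]
    (P : Matrix ((α ⊕ β) ⊕ (α ⊕ β)) ((α ⊕ β) ⊕ (α ⊕ β)) ℝ) : Matrix (α ⊕ α) (α ⊕ α) ℝ :=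
  (bipartite P).toBlocks₁₁ -
    (bipartite P).toBlocks₁₂ * (blockBB P)⁻¹ * (bipartite P).toBlocks₂₁

theorem memLp_tensor {α β : Type} [Fintype α] [Fintype β] (f : L2 α) (g : L2 β) :
    MemLp (fun x : α ⊕ β → ℝ => f (fun a => x (Sum.inl a)) * g (fun b => x (Sum.inr b)))
      2 volume := by
  have hmp := volume_measurePreserving_sumPiEquivProdPi (fun _ : α ⊕ β => ℝ)
  have hf := Lp.memLp f
  have hg := Lp.memLp g
  have hm : AEStronglyMeasurable (fun q : (α → ℝ) × (β → ℝ) => f q.1 * g q.2)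
      (volume.prod volume) :=
    (hf.1.comp_fst).mul (hg.1.comp_snd)
  have h : MemLp (fun q : (α → ℝ) × (β → ℝ) => f q.1 * g q.2) 2 (volume.prod volume) := by
    rw [memLp_two_iff_integrable_sq_norm hm]
    have := ((memLp_two_iff_integrable_sq_norm hf.1).1 hf).mul_prod
      ((memLp_two_iff_integrable_sq_norm hg.1).1 hg)
    simpa only [norm_mul, mul_pow] using this
  exact h.comp_measurePreserving hmp

/-- The tensor product `(f ⊗ g)(x_A, x_B) = f(x_A) g(x_B)` of two wave functions. -/
noncomputable def tensor {α β : Type} [Fintype α] [Fintype β] (f : L2 α) (g : L2 β) :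
    L2 (α ⊕ β) :=
  (memLp_tensor f g).toLp _

/-- `ρA` is the partial trace `Tr_B(ρ)`: for all `f, g` and every Hilbert basis `b` of the
Hilbert space of `B`, `⟨f, ρA g⟩ = ∑ₖ ⟨f ⊗ bₖ, ρ (g ⊗ bₖ)⟩`. -/
def IsPartialTraceB {α β : Type} [Fintype α] [Fintype β]
    (ρ : L2 (α ⊕ β) →L[ℂ] L2 (α ⊕ β)) (ρA : L2 α →L[ℂ] L2 α) : Prop :=
  ∀ (f g : L2 α) (κ : Type) (b : HilbertBasis κ ℂ (L2 β)),
    HasSum (fun k => ⟪tensor f (b k), ρ (tensor g (b k))⟫_ℂ) ⟪f, ρA g⟫_ℂ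

/-- The Gaussian `(π ħ)^(-n) (det M)^(1/2) exp(-(1/ħ) M (z - c) · (z - c))` on phase space. -/
noncomputable def phaseGaussian {ι : Type} [Fintype ι] [DecidableEq ι] (ħ : ℝ)
    (M : Matrix (ι ⊕ ι) (ι ⊕ ι) ℝ) (c z : Phase ι) : ℝ :=
  ((Real.pi * ħ) ^ (Fintype.card ι))⁻¹ * Real.sqrt M.det *
    Real.exp (-(1 / ħ) * ((M *ᵥ (z - c)) ⬝ᵥ (z - c)))

end ThawedGaussian

open ThawedGaussian

/-! The Wigner transform at `z` is, up to the factor `(πħ)^(-n)`, the expectation value of the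
parity operator in the state displaced by `-z` (`wigner_eq_inner`). Metaplectic operators commute
with parity and carry the displacement by `z` to the displacement by `S z`; this is checked on the
generators and passes to products and inverses (`IsMetaplectic.intertwines`). Hence the Wigner
function of the propagated coherent state at `z` is that of the vacuum at `S⁻¹(z - z_t)`: a Gaussian
with matrix `P = (S Sᵀ)⁻¹` and `det P = 1`. Completing the square in `z_B` gives its marginal, with
the Schur complement as matrix.

A marginal of a Wigner function is not yet a reduced density operator, so the wave function has to
be recovered. Fourier inversion in the momenta expresses `ψ(a) conj ψ(b)` through the Gaussian, and
so provides a continuous representative `φ` of `ψ` (`exists_continuous_of_wigner_eq`). Read `φ(x_A,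
x_B)` as the kernel `k` of a Hilbert-Schmidt operator `T` from `L²(B)` to `L²(A)`. Then `T T†` is
the partial trace. It is positive, its trace is `‖k‖² = 1`, and its kernel is `∫ k(x, y) conj k(x',
y) dy`.

By Fubini that kernel is the inverse Fourier transform of the marginal Gaussian
(`integral_gaussianKernel`). Fourier inversion then identifies the Wigner distribution of `T T†`,
and Plancherel turns `Tr (T T†)²`, the squared `L²` norm of the kernel, into `(2πħ)^(n_A)` times the
integral of the squared Gaussian, which is `√det M`. Finally `1 = det P = det P_BB · det M`. -/

namespace ThawedGaussian

/-! ### Displacement and parity operators on `L²` -/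

section Operators

variable {ι : Type} [Fintype ι]

theorem displacement_coeFn (ħ : ℝ) (z : Phase ι) (ψ : L2 ι) :
    (displacement ħ z ψ : (ι → ℝ) → ℂ) =ᵐ[volume]
      fun x => displacementPhase ħ z x * ψ (x - pos z) :=
  (memLp_displacement ħ z ψ).coeFn_toLp

/-- The parity operator `ψ(x) ↦ ψ(-x)` on `L²`. -/
noncomputable def parity (ψ : L2 ι) : L2 ι :=
  Lp.compMeasurePreserving Neg.neg (Measure.measurePreserving_neg volume) ψ

theorem parity_coeFn (ψ : L2 ι) :
    (parity ψ : (ι → ℝ) → ℂ) =ᵐ[volume] fun x => ψ (-x) :=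
  Lp.coeFn_compMeasurePreserving ψ _

theorem continuous_parity : Continuous (parity : L2 ι → L2 ι) :=
  (Lp.isometry_compMeasurePreserving _).continuous

theorem ae_comp_neg {f g : (ι → ℝ) → ℂ} (h : f =ᵐ[volume] g) :
    (fun x => f (-x)) =ᵐ[volume] fun x => g (-x) :=
  (Measure.measurePreserving_neg (volume : Measure (ι → ℝ))).quasiMeasurePreserving.ae_eq_comp h

theorem ae_comp_sub_right {f g : (ι → ℝ) → ℂ} (h : f =ᵐ[volume] g) (a : ι → ℝ) :
    (fun x => f (x - a)) =ᵐ[volume] fun x => g (x - a) :=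
  (measurePreserving_sub_right volume a).quasiMeasurePreserving.ae_eq_comp h

theorem displacement_sub (ħ : ℝ) (z : Phase ι) (ψ χ : L2 ι) :
    displacement ħ z (ψ - χ) = displacement ħ z ψ - displacement ħ z χ := by
  apply Lp.ext
  filter_upwards [displacement_coeFn ħ z (ψ - χ), displacement_coeFn ħ z ψ,
    displacement_coeFn ħ z χ, Lp.coeFn_sub (displacement ħ z ψ) (displacement ħ z χ),
    ae_comp_sub_right (Lp.coeFn_sub ψ χ) (pos z)] with x h1 h2 h3 h4 h5
  rw [h1, h4, Pi.sub_apply, h2, h3, h5, Pi.sub_apply, mul_sub]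

theorem displacement_smul (ħ : ℝ) (z : Phase ι) (c : ℂ) (ψ : L2 ι) :
    displacement ħ z (c • ψ) = c • displacement ħ z ψ := by
  apply Lp.ext
  filter_upwards [displacement_coeFn ħ z (c • ψ), displacement_coeFn ħ z ψ,
    Lp.coeFn_smul c (displacement ħ z ψ),
    ae_comp_sub_right (Lp.coeFn_smul c ψ) (pos z)] with x h1 h2 h3 h4
  rw [h1, h3, Pi.smul_apply, h2, h4, Pi.smul_apply, smul_eq_mul, smul_eq_mul]
  ring

theorem parity_smul (c : ℂ) (ψ : L2 ι) : parity (c • ψ) = c • parity ψ := by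
  apply Lp.ext
  filter_upwards [parity_coeFn (c • ψ), parity_coeFn ψ, Lp.coeFn_smul c (parity ψ),
    ae_comp_neg (Lp.coeFn_smul c ψ)] with x h1 h2 h3 h4
  rw [h1, h3, Pi.smul_apply, h2, h4, Pi.smul_apply]

theorem norm_displacement (ħ : ℝ) (z : Phase ι) (ψ : L2 ι) : ‖displacement ħ z ψ‖ = ‖ψ‖ := by
  have h : eLpNorm (fun x : ι → ℝ => displacementPhase ħ z x * ψ (x - pos z)) 2 volume
      = eLpNorm ψ 2 volume := by
    rw [← eLpNorm_comp_measurePreserving (Lp.aestronglyMeasurable ψ)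
      (measurePreserving_sub_right volume (pos z))]
    refine eLpNorm_congr_norm_ae (Filter.Eventually.of_forall fun x => ?_)
    rw [norm_mul, norm_displacementPhase, one_mul, Function.comp]
  rw [displacement, Lp.norm_toLp, h, Lp.norm_def]

theorem continuous_displacement (ħ : ℝ) (z : Phase ι) :
    Continuous (displacement ħ z : L2 ι → L2 ι) := by
  refine Isometry.continuous (Isometry.of_dist_eq fun ψ χ => ?_)
  rw [dist_eq_norm, dist_eq_norm, ← displacement_sub, norm_displacement]

/-- Simple functions in `L²` vanish off a set of finite measure, hence are integrable, and they are
dense. -/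
theorem dense_integrable : Dense {ψ : L2 ι | Integrable (ψ : (ι → ℝ) → ℂ) volume} := by
  refine (Lp.simpleFunc.dense (E := ℂ) (p := 2) (μ := (volume : Measure (ι → ℝ)))
    (by norm_num)).mono fun ψ hψ => ?_
  let φ : Lp.simpleFunc ℂ 2 (volume : Measure (ι → ℝ)) := ⟨ψ, hψ⟩
  have h1 := (SimpleFunc.memLp_iff_integrable (by norm_num) (by norm_num)).1
    (Lp.simpleFunc.memLp φ)
  exact h1.congr (Lp.simpleFunc.toSimpleFunc_eq_toFun φ)

/-- The Fourier generator is given by its integral formula only on integrable functions; this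
extends operator identities from there to all of `L²`. -/
theorem eq_of_eq_on_integrable {A B : L2 ι → L2 ι} (hA : Continuous A) (hB : Continuous B)
    (h : ∀ ψ : L2 ι, Integrable (ψ : (ι → ℝ) → ℂ) volume → A ψ = B ψ) (ψ : L2 ι) : A ψ = B ψ :=
  congrFun (hA.ext_on dense_integrable hB h) ψ

theorem integrable_displacement (ħ : ℝ) (z : Phase ι) {ψ : L2 ι}
    (hψ : Integrable (ψ : (ι → ℝ) → ℂ) volume) :
    Integrable (displacement ħ z ψ : (ι → ℝ) → ℂ) volume := by
  refine (Integrable.congr ?_ (displacement_coeFn ħ z ψ).symm)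
  have hc : Continuous (displacementPhase ħ z) := by
    unfold displacementPhase dotProduct
    fun_prop
  exact (hψ.comp_sub_right (pos z)).bdd_mul (c := 1) hc.aestronglyMeasurable
    (Filter.Eventually.of_forall fun x => (norm_displacementPhase ħ z x).le)

theorem integrable_parity {ψ : L2 ι} (hψ : Integrable (ψ : (ι → ℝ) → ℂ) volume) :
    Integrable (parity ψ : (ι → ℝ) → ℂ) volume :=
  hψ.comp_neg.congr (parity_coeFn ψ).symm

end Operators

/-! ### Covariance of metaplectic operators -/

section Intertwining

variable {ι : Type} [Fintype ι]

theorem pos_fromBlocks_mulVec (A B C D : Matrix ι ι ℝ) (z : Phase ι) :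
    pos (Matrix.fromBlocks A B C D *ᵥ z) = A *ᵥ pos z + B *ᵥ mom z := by
  ext i
  simp [pos, Matrix.fromBlocks_mulVec, Function.comp_def]
  rfl

theorem mom_fromBlocks_mulVec (A B C D : Matrix ι ι ℝ) (z : Phase ι) :
    mom (Matrix.fromBlocks A B C D *ᵥ z) = C *ᵥ pos z + D *ᵥ mom z := by
  ext i
  simp [mom, Matrix.fromBlocks_mulVec, Function.comp_def]
  rfl

theorem parity_comm_chirp {ħ : ℝ} (P : Matrix ι ι ℝ) (V : L2 ι ≃ₗᵢ[ℂ] L2 ι)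
    (hV : ∀ ψ : L2 ι, (V ψ : (ι → ℝ) → ℂ) =ᵐ[volume] fun x =>
      Complex.exp (Complex.I * (((P *ᵥ x) ⬝ᵥ x : ℝ) : ℂ) / (2 * (ħ : ℂ))) * ψ x) (ψ : L2 ι) :
    V (parity ψ) = parity (V ψ) := by
  apply Lp.ext
  filter_upwards [hV (parity ψ), parity_coeFn ψ,
    parity_coeFn (V ψ), ae_comp_neg (hV ψ)] with x h1 h2 h3 h4
  rw [h1, h2, h3, h4, mulVec_neg, neg_dotProduct_neg]

theorem parity_comm_fourier {ħ : ℝ} (c : ℂ) (F : L2 ι ≃ₗᵢ[ℂ] L2 ι)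
    (hF : ∀ ψ : L2 ι, Integrable (ψ : (ι → ℝ) → ℂ) volume →
      (F ψ : (ι → ℝ) → ℂ) =ᵐ[volume] fun x => c *
        ∫ y : ι → ℝ, Complex.exp (-(Complex.I * ((x ⬝ᵥ y : ℝ) : ℂ) / (ħ : ℂ))) * ψ y)
    (ψ : L2 ι) :
    F (parity ψ) = parity (F ψ) := by
  refine eq_of_eq_on_integrable (F.continuous.comp continuous_parity)
    (continuous_parity.comp F.continuous) (fun ψ hψ => ?_) ψ
  simp only [Function.comp]
  apply Lp.ext
  filter_upwards [hF _ (integrable_parity hψ), parity_coeFn (F ψ),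
    ae_comp_neg (hF ψ hψ)] with x h1 h2 h3
  rw [h1, h2, h3]
  congr 1
  rw [← integral_neg_eq_self]
  refine integral_congr_ae ?_
  filter_upwards [ae_comp_neg (parity_coeFn ψ)] with y hy
  rw [hy, neg_neg, dotProduct_neg, neg_dotProduct]

variable [DecidableEq ι]

/-- Expanding the quadratic phase at `x - x₀` produces the linear term `P x₀ · x`, which is exactly
the momentum added by the shear. -/
theorem displacement_comm_chirp {ħ : ℝ} (P : Matrix ι ι ℝ) (hP : P.IsSymm)
    (V : L2 ι ≃ₗᵢ[ℂ] L2 ι)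
    (hV : ∀ ψ : L2 ι, (V ψ : (ι → ℝ) → ℂ) =ᵐ[volume] fun x =>
      Complex.exp (Complex.I * (((P *ᵥ x) ⬝ᵥ x : ℝ) : ℂ) / (2 * (ħ : ℂ))) * ψ x)
    (z : Phase ι) (ψ : L2 ι) :
    V (displacement ħ z ψ) =
      displacement ħ ((Matrix.fromBlocks 1 0 P 1 : Matrix (ι ⊕ ι) (ι ⊕ ι) ℝ) *ᵥ z) (V ψ) := by
  set w := (Matrix.fromBlocks 1 0 P 1 : Matrix (ι ⊕ ι) (ι ⊕ ι) ℝ) *ᵥ z with hw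
  have hpos : pos w = pos z := by
    simp [hw, pos_fromBlocks_mulVec]
  have hmom : mom w = P *ᵥ pos z + mom z := by
    simp [hw, mom_fromBlocks_mulVec]
  apply Lp.ext
  filter_upwards [hV (displacement ħ z ψ), displacement_coeFn ħ z ψ,
    displacement_coeFn ħ w (V ψ), ae_comp_sub_right (hV ψ) (pos w)] with x h1 h2 h3 h4
  rw [h1, h2, h3, h4, hpos, ← mul_assoc, ← mul_assoc]
  congr 1
  unfold displacementPhase
  rw [hpos, hmom, ← Complex.exp_add, ← Complex.exp_add]
  congr 1
  have hs : (P *ᵥ x) ⬝ᵥ pos z = (P *ᵥ pos z) ⬝ᵥ x := by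
    rw [dotProduct_comm (P *ᵥ pos z), dotProduct_mulVec, ← mulVec_transpose, hP.eq]
  simp only [mulVec_sub, sub_dotProduct, dotProduct_sub, add_dotProduct, hs]
  push_cast
  -- Nothing is assumed about `ħ`; at `ħ = 0` both exponents vanish by the convention on division by
  -- zero.
  by_cases hħ : (ħ : ℂ) = 0
  · simp [hħ]
  · field_simp
    ring

theorem displacement_comm_scaling {ħ : ℝ} (L : Matrix ι ι ℝ) (hL : L.det ≠ 0) (c : ℂ)
    (V : L2 ι ≃ₗᵢ[ℂ] L2 ι)
    (hV : ∀ ψ : L2 ι, (V ψ : (ι → ℝ) → ℂ) =ᵐ[volume] fun x => c * ψ (L *ᵥ x))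
    (z : Phase ι) (ψ : L2 ι) :
    V (displacement ħ z ψ) =
      displacement ħ ((Matrix.fromBlocks L⁻¹ 0 0 Lᵀ : Matrix (ι ⊕ ι) (ι ⊕ ι) ℝ) *ᵥ z) (V ψ) := by
  set w := (Matrix.fromBlocks L⁻¹ 0 0 Lᵀ : Matrix (ι ⊕ ι) (ι ⊕ ι) ℝ) *ᵥ z with hw
  have hpos : pos w = L⁻¹ *ᵥ pos z := by
    simp [hw, pos_fromBlocks_mulVec]
  have hmom : mom w = Lᵀ *ᵥ mom z := by
    simp [hw, mom_fromBlocks_mulVec]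
  have hLL : L *ᵥ pos w = pos z := by
    rw [hpos, mulVec_mulVec, mul_nonsing_inv _ (isUnit_iff_ne_zero.2 hL), one_mulVec]
  -- An invertible linear map pulls null sets back to null sets, so almost everywhere identities may
  -- be composed with it.
  have hq : Measure.QuasiMeasurePreserving (fun x : ι → ℝ => L *ᵥ x) volume volume := by
    refine ⟨by fun_prop, ?_⟩
    have := Real.map_matrix_volume_pi_eq_smul_volume_pi hL
    rw [show (fun x : ι → ℝ => L *ᵥ x) = Matrix.toLin' L from rfl, this]
    exact Measure.smul_absolutelyContinuous
  apply Lp.ext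
  filter_upwards [hV (displacement ħ z ψ), hq.ae_eq_comp (displacement_coeFn ħ z ψ),
    displacement_coeFn ħ w (V ψ), ae_comp_sub_right (hV ψ) (pos w)] with x h1 h2 h3 h4
  simp only [Function.comp] at h2
  rw [h1, h2, h3, h4, mulVec_sub, hLL]
  have : displacementPhase ħ z (L *ᵥ x) = displacementPhase ħ w x := by
    unfold displacementPhase
    rw [hmom]
    have e1 : (Lᵀ *ᵥ mom z) ⬝ᵥ x = mom z ⬝ᵥ (L *ᵥ x) := by
      rw [mulVec_transpose, dotProduct_mulVec]
    have e2 : (Lᵀ *ᵥ mom z) ⬝ᵥ pos w = mom z ⬝ᵥ pos z := by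
      rw [mulVec_transpose, ← dotProduct_mulVec, hLL]
    rw [e1, e2]
  rw [this]
  ring

theorem parity_comm_scaling (L : Matrix ι ι ℝ) (hL : L.det ≠ 0) (c : ℂ)
    (V : L2 ι ≃ₗᵢ[ℂ] L2 ι)
    (hV : ∀ ψ : L2 ι, (V ψ : (ι → ℝ) → ℂ) =ᵐ[volume] fun x => c * ψ (L *ᵥ x)) (ψ : L2 ι) :
    V (parity ψ) = parity (V ψ) := by
  have hq : Measure.QuasiMeasurePreserving (fun x : ι → ℝ => L *ᵥ x) volume volume := by
    refine ⟨by fun_prop, ?_⟩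
    have := Real.map_matrix_volume_pi_eq_smul_volume_pi hL
    rw [show (fun x : ι → ℝ => L *ᵥ x) = Matrix.toLin' L from rfl, this]
    exact Measure.smul_absolutelyContinuous
  apply Lp.ext
  filter_upwards [hV (parity ψ), hq.ae_eq_comp (parity_coeFn ψ),
    parity_coeFn (V ψ), ae_comp_neg (hV ψ)] with x h1 h2 h3 h4
  simp only [Function.comp] at h2
  rw [h1, h2, h3, h4, mulVec_neg]

/-- The substitution `y ↦ y + x₀` turns translation into modulation and modulation into translation.
The half phase `p₀ · x₀ / 2` changes sign under `J`, which makes the identity exact and not merely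
true up to a phase. -/
theorem displacement_comm_fourier {ħ : ℝ} (c : ℂ) (F : L2 ι ≃ₗᵢ[ℂ] L2 ι)
    (hF : ∀ ψ : L2 ι, Integrable (ψ : (ι → ℝ) → ℂ) volume →
      (F ψ : (ι → ℝ) → ℂ) =ᵐ[volume] fun x => c *
        ∫ y : ι → ℝ, Complex.exp (-(Complex.I * ((x ⬝ᵥ y : ℝ) : ℂ) / (ħ : ℂ))) * ψ y)
    (z : Phase ι) (ψ : L2 ι) :
    F (displacement ħ z ψ) = displacement ħ (stdJ ι *ᵥ z) (F ψ) := by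
  refine eq_of_eq_on_integrable (F.continuous.comp (continuous_displacement ħ z))
    ((continuous_displacement ħ _).comp F.continuous) (fun ψ hψ => ?_) ψ
  simp only [Function.comp]
  set w := stdJ ι *ᵥ z with hw
  have hpos : pos w = mom z := by
    simp [hw, stdJ, pos_fromBlocks_mulVec]
  have hmom : mom w = -pos z := by
    simp [hw, stdJ, mom_fromBlocks_mulVec, neg_mulVec]
  apply Lp.ext
  filter_upwards [hF _ (integrable_displacement ħ z hψ), displacement_coeFn ħ w (F ψ),
    ae_comp_sub_right (hF ψ hψ) (pos w)] with x h1 h2 h3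
  rw [h1, h2, h3, mul_left_comm]
  congr 1
  have h4 : ∫ y : ι → ℝ, Complex.exp (-(Complex.I * ((x ⬝ᵥ y : ℝ) : ℂ) / (ħ : ℂ))) *
        (displacement ħ z ψ : (ι → ℝ) → ℂ) y =
      ∫ y : ι → ℝ, Complex.exp (-(Complex.I * ((x ⬝ᵥ y : ℝ) : ℂ) / (ħ : ℂ))) *
        (displacementPhase ħ z y * ψ (y - pos z)) := by
    refine integral_congr_ae ?_
    filter_upwards [displacement_coeFn ħ z ψ] with y hy
    rw [hy]
  rw [h4, ← integral_add_right_eq_self _ (pos z), ← integral_const_mul]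
  congr 1 with y
  rw [add_sub_cancel_right, ← mul_assoc, ← mul_assoc]
  congr 1
  unfold displacementPhase
  rw [hpos, hmom, ← Complex.exp_add, ← Complex.exp_add]
  congr 1
  have e1 : mom z ⬝ᵥ pos z = pos z ⬝ᵥ mom z := dotProduct_comm _ _
  have e2 : x ⬝ᵥ pos z = pos z ⬝ᵥ x := dotProduct_comm _ _
  simp only [dotProduct_add, sub_dotProduct, neg_dotProduct, e1, e2]
  push_cast
  ring

theorem det_stdJ_sq : (stdJ ι).det ^ 2 = 1 := by
  have h : stdJ ι * stdJ ι = -1 := by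
    rw [stdJ, fromBlocks_multiply, ← fromBlocks_one, fromBlocks_neg]
    simp
  rw [pow_two, ← det_mul, h, det_neg]
  simp

/-- Metaplectic operators intertwine displacements according to their projection, commute with
the parity operator, and project onto matrices of determinant `±1`. -/
theorem IsMetaplectic.intertwines {ħ : ℝ} {V : L2 ι ≃ₗᵢ[ℂ] L2 ι} {S : Matrix (ι ⊕ ι) (ι ⊕ ι) ℝ}
    (h : IsMetaplectic ħ V S) :
    (∀ (z : Phase ι) (ψ : L2 ι), V (displacement ħ z ψ) = displacement ħ (S *ᵥ z) (V ψ)) ∧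
      (∀ ψ : L2 ι, V (parity ψ) = parity (V ψ)) ∧ S.det ^ 2 = 1 := by
  induction h with
  | fourier F hF =>
    exact ⟨displacement_comm_fourier _ F hF, parity_comm_fourier _ F hF, det_stdJ_sq⟩
  | chirp P hP V hV =>
    exact ⟨displacement_comm_chirp P hP V hV, parity_comm_chirp P V hV, by simp⟩
  | scaling L hL m hm V hV =>
    exact ⟨displacement_comm_scaling L hL _ V hV, parity_comm_scaling L hL _ V hV,
      by simp [hL]⟩
  | mul V W S R hV hW ihV ihW =>
    refine ⟨fun z ψ => ?_, fun ψ => ?_, ?_⟩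
    · simp only [LinearIsometryEquiv.trans_apply]
      rw [ihW.1, ihV.1, mulVec_mulVec]
    · simp only [LinearIsometryEquiv.trans_apply]
      rw [ihW.2.1, ihV.2.1]
    · rw [det_mul, mul_pow, ihV.2.2, ihW.2.2, mul_one]
  | inv V S hV ih =>
    have hS : IsUnit S.det := isUnit_iff_ne_zero.2 fun h0 => by simpa [h0] using ih.2.2
    refine ⟨fun z ψ => ?_, fun ψ => ?_, ?_⟩
    · rw [LinearIsometryEquiv.symm_apply_eq, ih.1, mulVec_mulVec, mul_nonsing_inv _ hS,
        one_mulVec, LinearIsometryEquiv.apply_symm_apply]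
    · rw [LinearIsometryEquiv.symm_apply_eq, ih.2.1, LinearIsometryEquiv.apply_symm_apply]
    · have := ih.2.2
      rw [det_nonsing_inv, Ring.inverse_eq_inv', inv_pow, this, inv_one]

end Intertwining

/-! ### Wigner transforms as displaced parity expectations -/

section WignerTransform

variable {ι : Type} [Fintype ι]

theorem displacementPhase_mul_conj_neg (ħ : ℝ) (z : Phase ι) (u : ι → ℝ) :
    displacementPhase ħ z u * conj (displacementPhase ħ z (-u)) =
      Complex.exp (2 * Complex.I * ((mom z ⬝ᵥ u : ℝ) : ℂ) / (ħ : ℂ)) := by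
  unfold displacementPhase
  rw [← Complex.exp_conj, ← Complex.exp_add]
  congr 1
  simp only [map_div₀, map_mul, Complex.conj_I, Complex.conj_ofReal, dotProduct_neg]
  push_cast
  ring

theorem displacement_neg_coeFn (ħ : ℝ) (z : Phase ι) (ψ : L2 ι) :
    (fun x => (displacement ħ z ψ : (ι → ℝ) → ℂ) (-x)) =ᵐ[volume]
      fun x => displacementPhase ħ z (-x) * ψ (-x - pos z) :=
  ae_comp_neg (displacement_coeFn ħ z ψ)

/-- The two arguments of `ψ` have midpoint `-pos z` and difference `2u`, so this is a Wigner
integral in the variable `u = y/2`. -/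
theorem inner_parity_displacement (ħ : ℝ) (z : Phase ι) (ψ : L2 ι) :
    ⟪parity (displacement ħ z ψ), displacement ħ z ψ⟫_ℂ =
      ∫ u : ι → ℝ, Complex.exp (2 * Complex.I * ((mom z ⬝ᵥ u : ℝ) : ℂ) / (ħ : ℂ)) *
        (ψ (u - pos z) * conj (ψ (-u - pos z))) := by
  rw [L2.inner_def]
  refine integral_congr_ae ?_
  filter_upwards [parity_coeFn (displacement ħ z ψ), displacement_neg_coeFn ħ z ψ,
    displacement_coeFn ħ z ψ] with u h1 h2 h3
  rw [RCLike.inner_apply, h1, h2, h3, ← displacementPhase_mul_conj_neg, map_mul]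
  ring

/-- The Wigner transform as an expectation value of the displaced parity operator. -/
theorem wigner_eq_inner (ħ : ℝ) (ψ : L2 ι) (z : Phase ι) :
    wigner ħ ψ z = ((((Real.pi * ħ) ^ (Fintype.card ι))⁻¹ : ℝ) : ℂ) *
      ⟪parity (displacement ħ (-z) ψ), displacement ħ (-z) ψ⟫_ℂ := by
  rw [inner_parity_displacement, wigner, wignerKernel]
  set f : (ι → ℝ) → ℂ := fun y =>
    Complex.exp (-(Complex.I * ((mom z ⬝ᵥ y : ℝ) : ℂ) / (ħ : ℂ))) *
      (ψ (pos z + (1 / 2 : ℝ) • y) * conj (ψ (pos z - (1 / 2 : ℝ) • y))) with hf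
  -- The substitution is `y = 2u`; its Jacobian `2^n` changes the prefactor `(2πħ)^(-n)` into
  -- `(πħ)^(-n)`.
  have h1 : ∀ u : ι → ℝ, Complex.exp (2 * Complex.I * ((mom (-z) ⬝ᵥ u : ℝ) : ℂ) / (ħ : ℂ)) *
        (ψ (u - pos (-z)) * conj (ψ (-u - pos (-z)))) = f ((2 : ℝ) • u) := by
    intro u
    have e1 : mom (-z) = -mom z := rfl
    have e2 : pos (-z) = -pos z := rfl
    have e3 : pos z + (1 / 2 : ℝ) • ((2 : ℝ) • u) = u - -pos z := by
      rw [smul_smul]; norm_num [add_comm]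
    have e4 : pos z - (1 / 2 : ℝ) • ((2 : ℝ) • u) = -u - -pos z := by
      rw [smul_smul]; norm_num; abel
    simp only [hf, e1, e2, e3, e4, dotProduct_smul, neg_dotProduct]
    congr 2
    push_cast [smul_eq_mul]
    ring
  simp_rw [h1]
  rw [Measure.integral_comp_smul, Module.finrank_fintype_fun_eq_card, abs_of_pos (by positivity),
    Complex.real_smul, ← mul_assoc]
  congr 1
  push_cast
  rw [← mul_inv, ← mul_pow]
  congr 2
  ring

/-- Weyl relation. The scalar is the exponential of half the symplectic form over `ħ`; only its
modulus matters later, since phases cancel in `⟪parity ψ, ψ⟫`. -/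
theorem displacement_displacement (ħ : ℝ) (z w : Phase ι) (ψ : L2 ι) :
    ∃ c : ℂ, ‖c‖ = 1 ∧
      displacement ħ z (displacement ħ w ψ) = c • displacement ħ (z + w) ψ := by
  refine ⟨Complex.exp (((((mom z ⬝ᵥ pos w - mom w ⬝ᵥ pos z) / 2 / ħ : ℝ)) : ℂ) * Complex.I),
    Complex.norm_exp_ofReal_mul_I _, ?_⟩
  apply Lp.ext
  filter_upwards [displacement_coeFn ħ z (displacement ħ w ψ),
    ae_comp_sub_right (displacement_coeFn ħ w ψ) (pos z), displacement_coeFn ħ (z + w) ψ,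
    Lp.coeFn_smul (Complex.exp (((((mom z ⬝ᵥ pos w - mom w ⬝ᵥ pos z) / 2 / ħ : ℝ)) : ℂ)
      * Complex.I)) (displacement ħ (z + w) ψ)] with x h1 h2 h3 h4
  have e1 : mom (z + w) = mom z + mom w := rfl
  have e2 : pos (z + w) = pos z + pos w := rfl
  rw [h1, h2, h4, Pi.smul_apply, h3, smul_eq_mul, ← mul_assoc, ← mul_assoc, e2, sub_sub]
  congr 1
  unfold displacementPhase
  rw [← Complex.exp_add, ← Complex.exp_add, e1, e2]
  congr 1
  simp only [add_dotProduct, dotProduct_add, dotProduct_sub]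
  push_cast
  ring

theorem displacement_neg_coherentState {ħ : ℝ} (hħ : 0 < ħ) (z : Phase ι) :
    ∃ c : ℂ, ‖c‖ = 1 ∧
      displacement ħ (-z) (coherentState hħ z) = c • coherentState hħ (0 : Phase ι) := by
  refine ⟨Complex.exp ((((mom z ⬝ᵥ pos z / 2 / ħ : ℝ)) : ℂ) * Complex.I),
    Complex.norm_exp_ofReal_mul_I _, ?_⟩
  apply Lp.ext
  filter_upwards [displacement_coeFn ħ (-z) (coherentState hħ z),
    ae_comp_sub_right (memLp_coherentFun hħ z).coeFn_toLp (pos (-z)),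
    (memLp_coherentFun hħ (0 : Phase ι)).coeFn_toLp,
    Lp.coeFn_smul (Complex.exp ((((mom z ⬝ᵥ pos z / 2 / ħ : ℝ)) : ℂ) * Complex.I))
      (coherentState hħ (0 : Phase ι))] with x h1 h2 h3 h4
  have e1 : mom (-z) = -mom z := rfl
  have e2 : pos (-z) = -pos z := rfl
  have e3 : mom (0 : Phase ι) = 0 := rfl
  have e4 : pos (0 : Phase ι) = 0 := rfl
  change (coherentState hħ z : (ι → ℝ) → ℂ) _ = _ at h2
  change (coherentState hħ (0 : Phase ι) : (ι → ℝ) → ℂ) _ = _ at h3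
  rw [h1, h2, h4, Pi.smul_apply, h3, smul_eq_mul]
  unfold displacementPhase coherentFun
  rw [e1, e2, e3, e4]
  simp only [sub_neg_eq_add, add_sub_cancel_right, sub_zero, zero_dotProduct, Complex.ofReal_zero,
    mul_zero, zero_div, Complex.exp_zero, mul_one]
  have e5 : Complex.exp (Complex.I * ((-mom z ⬝ᵥ x - -mom z ⬝ᵥ -pos z / 2 : ℝ) : ℂ) / (ħ : ℂ)) *
      Complex.exp (Complex.I * ((mom z ⬝ᵥ (x + pos z) : ℝ) : ℂ) / (ħ : ℂ)) =
      Complex.exp ((((mom z ⬝ᵥ pos z / 2 / ħ : ℝ)) : ℂ) * Complex.I) := by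
    rw [← Complex.exp_add]
    congr 1
    simp only [neg_dotProduct, dotProduct_neg, dotProduct_add]
    push_cast
    ring
  rw [← e5]
  ring

/-- The two shifted Gaussians multiply to `exp(-|u|²/ħ) exp(-|pos w|²/ħ)`, and the Fourier integral
over `u` supplies `exp(-|mom w|²/ħ)`. The normalization cancels against the factor `(πħ)^(n/2)` of
that integral. -/
theorem inner_parity_displacement_coherentState {ħ : ℝ} (hħ : 0 < ħ) (w : Phase ι) :
    ⟪parity (displacement ħ w (coherentState hħ 0)), displacement ħ w (coherentState hħ 0)⟫_ℂ =
      ((Real.exp (-(1 / ħ) * (w ⬝ᵥ w)) : ℝ) : ℂ) := by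
  have hc := (memLp_coherentFun hħ (0 : Phase ι)).coeFn_toLp
  have hħ' : (ħ : ℂ) ≠ 0 := Complex.ofReal_ne_zero.2 hħ.ne'
  rw [inner_parity_displacement]
  have h1 : ∀ᵐ u : ι → ℝ, Complex.exp (2 * Complex.I * ((mom w ⬝ᵥ u : ℝ) : ℂ) / (ħ : ℂ)) *
        ((coherentState hħ 0 : (ι → ℝ) → ℂ) (u - pos w) *
          conj ((coherentState hħ 0 : (ι → ℝ) → ℂ) (-u - pos w))) =
      ((((Real.pi * ħ) ^ (-(Fintype.card ι : ℝ) / 2) : ℝ) : ℂ)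
        * ((Real.exp (-(1 / ħ) * (pos w ⬝ᵥ pos w)) : ℝ) : ℂ)) *
        Complex.exp (-(1 / (ħ : ℂ)) * ∑ i, (u i : ℂ) ^ 2 +
          ∑ i, (2 * Complex.I * (mom w i : ℂ) / (ħ : ℂ)) * u i) := by
    filter_upwards [ae_comp_sub_right hc (pos w),
      ae_comp_neg (ae_comp_sub_right hc (pos w))] with u h2 h3
    change (coherentState hħ (0 : Phase ι) : (ι → ℝ) → ℂ) _ = _ at h2 h3
    rw [h2, h3]
    unfold coherentFun
    have e3 : mom (0 : Phase ι) = 0 := rfl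
    have e4 : pos (0 : Phase ι) = 0 := rfl
    have e5 : (Real.pi * ħ) ^ (-(Fintype.card ι : ℝ) / 2) =
        (Real.pi * ħ) ^ (-(Fintype.card ι : ℝ) / 4) *
          (Real.pi * ħ) ^ (-(Fintype.card ι : ℝ) / 4) := by
      rw [← Real.rpow_add (by positivity)]
      congr 1
      ring
    rw [e3, e4, e5]
    simp only [sub_zero, zero_dotProduct, Complex.ofReal_zero,
      mul_zero, zero_div, Complex.exp_zero, mul_one, map_mul, Complex.conj_ofReal]
    rw [Complex.ofReal_mul, Complex.ofReal_exp, Complex.ofReal_exp, Complex.ofReal_exp]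
    have e6 : Complex.exp (2 * Complex.I * ((mom w ⬝ᵥ u : ℝ) : ℂ) / (ħ : ℂ)) *
        (Complex.exp ((-((u - pos w) ⬝ᵥ (u - pos w)) / (2 * ħ) : ℝ) : ℂ) *
         Complex.exp ((-((-u - pos w) ⬝ᵥ (-u - pos w)) / (2 * ħ) : ℝ) : ℂ)) =
        Complex.exp ((-(1 / ħ) * (pos w ⬝ᵥ pos w) : ℝ) : ℂ) *
        Complex.exp (-(1 / (ħ : ℂ)) * ∑ i, (u i : ℂ) ^ 2 +
          ∑ i, (2 * Complex.I * (mom w i : ℂ) / (ħ : ℂ)) * u i) := by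
      rw [← Complex.exp_add, ← Complex.exp_add, ← Complex.exp_add]
      congr 1
      have e7 : ∑ i, (u i : ℂ) ^ 2 = ((u ⬝ᵥ u : ℝ) : ℂ) := by
        simp [dotProduct, pow_two]
      have e8 : ∑ i, (2 * Complex.I * (mom w i : ℂ) / (ħ : ℂ)) * u i =
          2 * Complex.I * ((mom w ⬝ᵥ u : ℝ) : ℂ) / (ħ : ℂ) := by
        simp only [dotProduct, Complex.ofReal_sum, Finset.mul_sum, Finset.sum_div,
          Complex.ofReal_mul]
        exact Finset.sum_congr rfl fun i _ => by ring
      rw [e7, e8]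
      simp only [sub_dotProduct, dotProduct_sub, neg_dotProduct, dotProduct_neg,
        dotProduct_comm (pos w) u]
      push_cast
      field_simp
      ring
    linear_combination ((((Real.pi * ħ) ^ (-(Fintype.card ι : ℝ) / 4) : ℝ) : ℂ) *
          (((Real.pi * ħ) ^ (-(Fintype.card ι : ℝ) / 4) : ℝ) : ℂ)) * e6
  have hb : 0 < (1 / (ħ : ℂ)).re := by
    rw [← Complex.ofReal_one, ← Complex.ofReal_div, Complex.ofReal_re]
    positivity
  rw [integral_congr_ae h1, integral_const_mul, GaussianFourier.integral_cexp_neg_mul_sum_add hb]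
  have e9 : ((Real.pi : ℂ) / (1 / (ħ : ℂ))) ^ ((Fintype.card ι : ℂ) / 2) =
      (((Real.pi * ħ) ^ ((Fintype.card ι : ℝ) / 2) : ℝ) : ℂ) := by
    rw [Complex.ofReal_cpow (by positivity)]
    push_cast
    congr 1
    field_simp
  have e10 : (∑ i, (2 * Complex.I * (mom w i : ℂ) / (ħ : ℂ)) ^ 2) / (4 * (1 / (ħ : ℂ))) =
      ((-(1 / ħ) * (mom w ⬝ᵥ mom w) : ℝ) : ℂ) := by
    have : ∀ i, (2 * Complex.I * (mom w i : ℂ) / (ħ : ℂ)) ^ 2 =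
        (-4 / (ħ : ℂ) ^ 2) * ((mom w i * mom w i : ℝ) : ℂ) := by
      intro i
      rw [div_pow, mul_pow, mul_pow, Complex.I_sq]
      push_cast
      ring
    simp_rw [this]
    rw [← Finset.mul_sum, ← Complex.ofReal_sum]
    simp only [dotProduct]
    push_cast
    field_simp
  have e11 : w ⬝ᵥ w = pos w ⬝ᵥ pos w + mom w ⬝ᵥ mom w := by
    simp [dotProduct, pos, mom]
  have e12 : (Real.pi * ħ) ^ (-(Fintype.card ι : ℝ) / 2) *
      (Real.pi * ħ) ^ ((Fintype.card ι : ℝ) / 2) = 1 := by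
    rw [← Real.rpow_add (by positivity), neg_div, neg_add_cancel, Real.rpow_zero]
  rw [e9, e10, ← Complex.ofReal_exp, e11, ← Complex.ofReal_mul, ← Complex.ofReal_mul,
    ← Complex.ofReal_mul, mul_add, Real.exp_add]
  congr 1
  linear_combination (Real.exp (-(1 / ħ) * (pos w ⬝ᵥ pos w)) *
    Real.exp (-(1 / ħ) * (mom w ⬝ᵥ mom w))) * e12

theorem inner_parity_smul {c : ℂ} (hc : ‖c‖ = 1) (ψ : L2 ι) :
    ⟪parity (c • ψ), c • ψ⟫_ℂ = ⟪parity ψ, ψ⟫_ℂ := by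
  rw [parity_smul, inner_smul_left, inner_smul_right, ← mul_assoc, mul_comm (conj c),
    Complex.mul_conj, Complex.normSq_eq_norm_sq, hc]
  simp

/-- The vacuum is even, so its squared norm is its parity expectation, which the previous Gaussian
integral gives at `w = 0`. -/
theorem norm_coherentState {ħ : ℝ} (hħ : 0 < ħ) (z : Phase ι) : ‖coherentState hħ z‖ = 1 := by
  obtain ⟨c, hc, h⟩ := displacement_neg_coherentState hħ z
  have h1 := congrArg norm h
  rw [norm_displacement, norm_smul, hc, one_mul] at h1
  have h2 : parity (displacement ħ 0 (coherentState hħ (0 : Phase ι))) =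
      displacement ħ 0 (coherentState hħ 0) := by
    apply Lp.ext
    have hc := (memLp_coherentFun hħ (0 : Phase ι)).coeFn_toLp
    filter_upwards [parity_coeFn (displacement ħ 0 (coherentState hħ (0 : Phase ι))),
      displacement_neg_coeFn ħ 0 (coherentState hħ 0),
      displacement_coeFn ħ 0 (coherentState hħ 0), ae_comp_sub_right hc (pos 0),
      ae_comp_neg (ae_comp_sub_right hc (pos 0))] with x h1 h2 h3 h4 h5
    change (coherentState hħ (0 : Phase ι) : (ι → ℝ) → ℂ) _ = _ at h4 h5
    have e1 : mom (0 : Phase ι) = 0 := rfl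
    have e2 : pos (0 : Phase ι) = 0 := rfl
    rw [h1, h2, h3, h4, h5]
    simp only [displacementPhase, coherentFun, e1, e2, zero_dotProduct, sub_zero, neg_dotProduct_neg]
  have h3 := inner_parity_displacement_coherentState hħ (0 : Phase ι)
  rw [h2, inner_self_eq_norm_sq_to_K, norm_displacement, ← h1, dotProduct_zero, mul_zero,
    Real.exp_zero] at h3
  have h4 : ‖coherentState hħ z‖ ^ 2 = 1 := by
    refine Complex.ofReal_injective (Eq.trans ?_ h3)
    norm_cast
  exact (pow_eq_one_iff_of_nonneg (norm_nonneg _) two_ne_zero).1 h4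

theorem norm_semiclassicalPropagator (ħ γ : ℝ) (zt z₀ : Phase ι) (V : L2 ι ≃ₗᵢ[ℂ] L2 ι)
    (ψ : L2 ι) : ‖semiclassicalPropagator ħ γ zt z₀ V ψ‖ = ‖ψ‖ := by
  rw [semiclassicalPropagator, norm_smul, norm_displacement, LinearIsometryEquiv.norm_map,
    norm_displacement, mul_div_assoc, ← Complex.ofReal_div, mul_comm Complex.I,
    Complex.norm_exp_ofReal_mul_I, one_mul]

variable [DecidableEq ι]

/-- The Wigner transform of a propagated coherent state is a Gaussian centered on the orbit. -/
theorem wigner_semiclassicalPropagator {ħ : ℝ} (hħ : 0 < ħ) {V : L2 ι ≃ₗᵢ[ℂ] L2 ι}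
    {S : Matrix (ι ⊕ ι) (ι ⊕ ι) ℝ} (hV : IsMetaplectic ħ V S) (γ : ℝ) (zt z₀ z : Phase ι) :
    wigner ħ (semiclassicalPropagator ħ γ zt z₀ V (coherentState hħ z₀)) z =
      (phaseGaussian ħ (S * Sᵀ)⁻¹ zt z : ℂ) := by
  obtain ⟨hT, hpar, hdet⟩ := hV.intertwines
  have hS : IsUnit S.det := isUnit_iff_ne_zero.2 fun h0 => by simp [h0] at hdet
  obtain ⟨c, hc, hc'⟩ := displacement_neg_coherentState hħ z₀
  have hγ : ‖Complex.exp (Complex.I * (γ : ℂ) / (ħ : ℂ))‖ = 1 := by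
    rw [mul_div_assoc, ← Complex.ofReal_div, mul_comm]
    exact Complex.norm_exp_ofReal_mul_I _
  obtain ⟨d, hd, hd'⟩ := displacement_displacement ħ (-z) zt (V (coherentState hħ 0))
  -- In this form the displacement can be pulled back through `V`; `V` then commutes with parity and
  -- disappears from the inner product by unitarity.
  have hw : -z + zt = S *ᵥ (S⁻¹ *ᵥ (-z + zt)) := by
    rw [mulVec_mulVec, mul_nonsing_inv _ hS, one_mulVec]
  rw [wigner_eq_inner, semiclassicalPropagator, displacement_smul, inner_parity_smul hγ, hc',
    map_smul, displacement_smul, displacement_smul, inner_parity_smul hc, hd',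
    inner_parity_smul hd, hw, ← hT, ← hpar, LinearIsometryEquiv.inner_map_map,
    inner_parity_displacement_coherentState, phaseGaussian]
  have hP : ((S * Sᵀ)⁻¹).det = 1 := by
    rw [det_nonsing_inv, det_mul, det_transpose, ← pow_two, hdet, Ring.inverse_one]
  have hq : (S⁻¹ *ᵥ (-z + zt)) ⬝ᵥ (S⁻¹ *ᵥ (-z + zt)) =
      ((S * Sᵀ)⁻¹ *ᵥ (z - zt)) ⬝ᵥ (z - zt) := by
    rw [Matrix.mul_inv_rev, ← transpose_nonsing_inv, ← mulVec_mulVec, mulVec_transpose,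
      ← dotProduct_mulVec, show -z + zt = -(z - zt) by abel, mulVec_neg, neg_dotProduct_neg]
  rw [hP, hq]
  push_cast
  simp

end WignerTransform

/-! ### Fourier inversion and Plancherel in semiclassical normalization -/

section Fourier

open scoped FourierTransform SchwartzMap

/-- Fourier inversion almost everywhere for an integrable function with integrable transform. -/
theorem ae_eq_fourierInv_fourier {V : Type*} [NormedAddCommGroup V] [InnerProductSpace ℝ V]
    [MeasurableSpace V] [BorelSpace V] [FiniteDimensional ℝ V] {f : V → ℂ}
    (hf : Integrable f) (hf' : Integrable (𝓕 f)) : ∀ᵐ v, f v = 𝓕⁻ (𝓕 f) v := by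
  have hcont : Continuous (𝓕⁻ (𝓕 f)) :=
    VectorFourier.fourierIntegral_continuous (L := -innerₗ V) Real.continuous_fourierChar
      (by simpa using! continuous_inner.neg) hf'
  -- It suffices to test against smooth compactly supported `g`. Such a `g` is Schwartz, hence the
  -- Fourier transform of `𝓕⁻ g`; moving transforms across the pairing brings both sides to `∫ 𝓕⁻ g
  -- · 𝓕 f`.
  refine ae_eq_of_integral_contDiff_smul_eq hf.locallyIntegrable hcont.locallyIntegrable ?_
  intro g hg hgc
  have hgc' : HasCompactSupport (fun v => (g v : ℂ)) := hgc.comp_left Complex.ofReal_zero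
  let φ : 𝓢(V, ℂ) := hgc'.toSchwartzMap (Complex.ofRealCLM.contDiff.comp hg)
  have hφ : ∀ v, φ v = (g v : ℂ) := fun v => rfl
  have e1 : ∫ v, g v • f v = ∫ v, (𝓕⁻ φ : 𝓢(V, ℂ)) v • (𝓕 f) v := by
    have h := VectorFourier.integral_fourierIntegral_smul_eq_flip (L := innerₗ V)
      Real.continuous_fourierChar continuous_inner ((𝓕⁻ φ : 𝓢(V, ℂ)).integrable (μ := volume)) hf
    have h2 : ∀ v, VectorFourier.fourierIntegral Real.fourierChar volume (innerₗ V) (𝓕⁻ φ : 𝓢(V, ℂ)) v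
        = (g v : ℂ) := by
      intro v
      change 𝓕 ((𝓕⁻ φ : 𝓢(V, ℂ)) : V → ℂ) v = _
      rw [← SchwartzMap.fourier_coe, FourierTransform.fourier_fourierInv_eq, hφ]
    simp_rw [h2, flip_innerₗ] at h
    exact h
  have e2 : ∫ v, g v • 𝓕⁻ (𝓕 f) v = ∫ v, (𝓕⁻ φ : 𝓢(V, ℂ)) v • (𝓕 f) v := by
    have h := VectorFourier.integral_fourierIntegral_smul_eq_flip (L := -innerₗ V)
      Real.continuous_fourierChar (by simpa using! continuous_inner.neg) (φ.integrable (μ := volume)) hf'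
    have h3 : (-innerₗ V).flip = -innerₗ V := by
      ext v w
      simp [real_inner_comm]
    rw [h3] at h
    rw [SchwartzMap.fourierInv_coe]
    exact h.symm
  rw [e1, e2]

variable {ι : Type} [Fintype ι]

/-- Fourier inversion lives on inner product spaces, whereas `ι → ℝ` carries the sup norm; the
identification with Euclidean space preserves volume. -/
theorem integral_euclidean (f : (ι → ℝ) → ℂ) :
    ∫ v : EuclideanSpace ℝ ι, f (WithLp.ofLp v) = ∫ y, f y :=
  (PiLp.volume_preserving_ofLp ι).integral_comp
    (MeasurableEquiv.toLp 2 (ι → ℝ)).symm.measurableEmbedding f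

theorem integrable_euclidean {f : (ι → ℝ) → ℂ} :
    Integrable (fun v : EuclideanSpace ℝ ι => f (WithLp.ofLp v)) ↔ Integrable f :=
  (PiLp.volume_preserving_ofLp ι).integrable_comp_emb
    (MeasurableEquiv.toLp 2 (ι → ℝ)).symm.measurableEmbedding

theorem fourier_euclidean (f : (ι → ℝ) → ℂ) (q : EuclideanSpace ℝ ι) :
    𝓕 (fun v : EuclideanSpace ℝ ι => f (WithLp.ofLp v)) q =
      ∫ y, Complex.exp (-(2 * Real.pi * Complex.I * ((WithLp.ofLp q ⬝ᵥ y : ℝ) : ℂ))) * f y := by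
  rw [Real.fourier_eq', ← integral_euclidean]
  congr 1 with v
  rw [smul_eq_mul, EuclideanSpace.inner_eq_star_dotProduct, star_trivial]
  congr 2
  push_cast
  ring

theorem fourierInv_euclidean (f : (ι → ℝ) → ℂ) (q : EuclideanSpace ℝ ι) :
    𝓕⁻ (fun v : EuclideanSpace ℝ ι => f (WithLp.ofLp v)) q =
      ∫ y, Complex.exp (2 * Real.pi * Complex.I * ((WithLp.ofLp q ⬝ᵥ y : ℝ) : ℂ)) * f y := by
  rw [Real.fourierInv_eq', ← integral_euclidean]
  congr 1 with v
  rw [smul_eq_mul, EuclideanSpace.inner_eq_star_dotProduct, star_trivial]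
  congr 2
  push_cast
  ring

theorem integral_exp_scale {ħ : ℝ} (hħ : 0 < ħ) (w : (ι → ℝ) → ℂ) (y : ι → ℝ) :
    ∫ q, Complex.exp (2 * Real.pi * Complex.I * ((y ⬝ᵥ q : ℝ) : ℂ)) *
        w ((2 * Real.pi * ħ) • q) =
      ((((2 * Real.pi * ħ) ^ (Fintype.card ι))⁻¹ : ℝ) : ℂ) *
        ∫ p, Complex.exp (Complex.I * ((p ⬝ᵥ y : ℝ) : ℂ) / (ħ : ℂ)) * w p := by
  have h := Measure.integral_comp_smul (volume : Measure (ι → ℝ))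
    (fun p => Complex.exp (Complex.I * ((p ⬝ᵥ y : ℝ) : ℂ) / (ħ : ℂ)) * w p) (2 * Real.pi * ħ)
  rw [Module.finrank_fintype_fun_eq_card, abs_of_pos (by positivity), Complex.real_smul] at h
  rw [← h]
  congr 1 with q
  congr 2
  have : (ħ : ℂ) ≠ 0 := Complex.ofReal_ne_zero.2 hħ.ne'
  rw [smul_dotProduct, dotProduct_comm q y]
  push_cast [smul_eq_mul]
  field_simp

/-- Semiclassical Fourier inversion, for an integrable function with integrable transform. -/
theorem ae_eq_integral_of_transform {ħ : ℝ} (hħ : 0 < ħ) {g w : (ι → ℝ) → ℂ}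
    (hg : Integrable g) (hw : Integrable w)
    (h : ∀ p, ((((2 * Real.pi * ħ) ^ (Fintype.card ι))⁻¹ : ℝ) : ℂ) *
      ∫ y, Complex.exp (-(Complex.I * ((p ⬝ᵥ y : ℝ) : ℂ) / (ħ : ℂ))) * g y = w p) :
    ∀ᵐ y, g y = ∫ p, Complex.exp (Complex.I * ((p ⬝ᵥ y : ℝ) : ℂ) / (ħ : ℂ)) * w p := by
  have h2 : (0 : ℝ) < 2 * Real.pi * ħ := by positivity
  have hħ' : (ħ : ℂ) ≠ 0 := Complex.ofReal_ne_zero.2 hħ.ne'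
  set N : ℂ := (((2 * Real.pi * ħ) ^ (Fintype.card ι) : ℝ) : ℂ) with hN
  have hN0 : N ≠ 0 := Complex.ofReal_ne_zero.2 (by positivity)
  have hF : 𝓕 (fun v : EuclideanSpace ℝ ι => g (WithLp.ofLp v)) =
      fun q => (fun q : ι → ℝ => N * w ((2 * Real.pi * ħ) • q)) (WithLp.ofLp q) := by
    ext q
    rw [fourier_euclidean]
    simp only []
    rw [← h, Complex.ofReal_inv, ← hN, mul_inv_cancel_left₀ hN0]
    congr 1 with y
    congr 2
    rw [smul_dotProduct]
    push_cast [smul_eq_mul]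
    field_simp
  have hi : Integrable (fun q : ι → ℝ => N * w ((2 * Real.pi * ħ) • q)) :=
    (hw.comp_smul h2.ne').const_mul N
  have key := ae_eq_fourierInv_fourier (integrable_euclidean.2 hg)
    (by rw [hF]; exact integrable_euclidean.2 hi)
  have key2 := (PiLp.volume_preserving_toLp ι).quasiMeasurePreserving.ae key
  filter_upwards [key2] with y hy
  rw [hF, fourierInv_euclidean (fun q => N * w ((2 * Real.pi * ħ) • q))] at hy
  simp only [mul_left_comm _ N, integral_const_mul] at hy
  rw [integral_exp_scale hħ w y, Complex.ofReal_inv, ← hN, mul_inv_cancel_left₀ hN0] at hy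
  exact hy

/-- Semiclassical Fourier inversion, for a continuous integrable function with integrable
inverse transform. -/
theorem transform_integral_eq {ħ : ℝ} (hħ : 0 < ħ) {g w : (ι → ℝ) → ℂ}
    (hg : Integrable g) (hw : Integrable w) (hwc : Continuous w)
    (h : ∀ y, g y = ∫ p, Complex.exp (Complex.I * ((p ⬝ᵥ y : ℝ) : ℂ) / (ħ : ℂ)) * w p)
    (p : ι → ℝ) :
    ((((2 * Real.pi * ħ) ^ (Fintype.card ι))⁻¹ : ℝ) : ℂ) *
      ∫ y, Complex.exp (-(Complex.I * ((p ⬝ᵥ y : ℝ) : ℂ) / (ħ : ℂ))) * g y = w p := by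
  have h2 : (0 : ℝ) < 2 * Real.pi * ħ := by positivity
  have hħ' : (ħ : ℂ) ≠ 0 := Complex.ofReal_ne_zero.2 hħ.ne'
  have hF : 𝓕⁻ (fun v : EuclideanSpace ℝ ι => w ((2 * Real.pi * ħ) • WithLp.ofLp v)) =
      fun y => (fun y : ι → ℝ => ((((2 * Real.pi * ħ) ^ (Fintype.card ι))⁻¹ : ℝ) : ℂ) * g y)
        (WithLp.ofLp y) := by
    ext y
    rw [fourierInv_euclidean (fun q => w ((2 * Real.pi * ħ) • q)), integral_exp_scale hħ w]
    simp only []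
    rw [h]
  have hi : Integrable (𝓕⁻ (fun v : EuclideanSpace ℝ ι =>
      w ((2 * Real.pi * ħ) • WithLp.ofLp v))) := by
    rw [hF]
    exact integrable_euclidean.2 (hg.const_mul _)
  have hi' : Integrable (𝓕 (fun v : EuclideanSpace ℝ ι =>
      w ((2 * Real.pi * ħ) • WithLp.ofLp v))) := by
    refine hi.comp_neg.congr (Filter.Eventually.of_forall fun v => ?_)
    simp only [Real.fourierInv_eq_fourier_neg, neg_neg]
  have hcont : Continuous (fun v : EuclideanSpace ℝ ι =>
      w ((2 * Real.pi * ħ) • WithLp.ofLp v)) := by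
    fun_prop
  -- Continuity of `w` makes the inversion hold at every point; evaluating at `p / (2πħ)` undoes the
  -- rescaling.
  have key := congrFun (hcont.fourier_fourierInv_eq
    (integrable_euclidean.2 (hw.comp_smul h2.ne')) hi')
    (WithLp.toLp 2 ((2 * Real.pi * ħ)⁻¹ • p))
  rw [hF, fourier_euclidean
    (fun y => ((((2 * Real.pi * ħ) ^ (Fintype.card ι))⁻¹ : ℝ) : ℂ) * g y)] at key
  simp only [smul_smul, mul_inv_cancel₀ h2.ne', one_smul] at key
  rw [← key, ← integral_const_mul]
  congr 1 with y
  rw [mul_left_comm]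
  congr 2
  rw [smul_dotProduct]
  push_cast [smul_eq_mul]
  field_simp

/-- The semiclassical Plancherel identity. -/
theorem integral_norm_sq_eq_of_transform {ħ : ℝ} (hħ : 0 < ħ) {g w : (ι → ℝ) → ℂ}
    (hg : Integrable g) (hw : Integrable w) (hwc : Continuous w)
    (h : ∀ y, g y = ∫ p, Complex.exp (Complex.I * ((p ⬝ᵥ y : ℝ) : ℂ) / (ħ : ℂ)) * w p) :
    ∫ y, ‖g y‖ ^ 2 = (2 * Real.pi * ħ) ^ (Fintype.card ι) * ∫ p, ‖w p‖ ^ 2 := by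
  set N : ℂ := (((2 * Real.pi * ħ) ^ (Fintype.card ι) : ℝ) : ℂ) with hN
  have hN0 : N ≠ 0 := Complex.ofReal_ne_zero.2 (by positivity)
  have hT := transform_integral_eq hħ hg hw hwc h
  have hint : Integrable (fun r : (ι → ℝ) × (ι → ℝ) =>
      Complex.exp (-(Complex.I * ((r.2 ⬝ᵥ r.1 : ℝ) : ℂ) / (ħ : ℂ))) *
        (g r.1 * conj (w r.2))) (volume.prod volume) := by
    have hw' : Integrable (fun p => conj (w p)) :=
      (LinearIsometryEquiv.integrable_comp_iff Complex.conjLIE).2 hw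
    refine Integrable.bdd_mul (c := 1) (hg.mul_prod hw') ?_ ?_
    · refine Continuous.aestronglyMeasurable ?_
      unfold dotProduct
      fun_prop
    · refine Filter.Eventually.of_forall fun r => ?_
      rw [mul_div_assoc, ← Complex.ofReal_div, ← mul_neg, ← Complex.ofReal_neg, mul_comm]
      exact (Complex.norm_exp_ofReal_mul_I _).le
  -- Write `conj (g y)` as an integral over `p` and exchange the integrals; the inner integral over
  -- `y` is then the transform of `g`, that is `N * w p`.
  have e : ∫ y, g y * conj (g y) = N * ∫ p, w p * conj (w p) := by
    calc ∫ y, g y * conj (g y)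
        = ∫ y, ∫ p, Complex.exp (-(Complex.I * ((p ⬝ᵥ y : ℝ) : ℂ) / (ħ : ℂ))) *
            (g y * conj (w p)) := by
          congr 1 with y
          rw [congrArg conj (h y), ← integral_conj, ← integral_const_mul]
          congr 1 with p
          rw [map_mul, ← Complex.exp_conj, map_div₀, map_mul, Complex.conj_I,
            Complex.conj_ofReal, Complex.conj_ofReal, neg_mul, neg_div]
          ring
      _ = ∫ p, ∫ y, Complex.exp (-(Complex.I * ((p ⬝ᵥ y : ℝ) : ℂ) / (ħ : ℂ))) *
            (g y * conj (w p)) := integral_integral_swap hint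
      _ = ∫ p, N * (w p * conj (w p)) := by
          congr 1 with p
          simp_rw [← mul_assoc]
          rw [integral_mul_const]
          congr 1
          rw [← hT p, Complex.ofReal_inv, ← hN, mul_inv_cancel_left₀ hN0]
      _ = N * ∫ p, w p * conj (w p) := integral_const_mul _ _
  have e2 : ∀ f : (ι → ℝ) → ℂ, ∫ y, f y * conj (f y) = ((∫ y, ‖f y‖ ^ 2 : ℝ) : ℂ) := by
    intro f
    rw [← integral_complex_ofReal]
    congr 1 with y
    rw [Complex.mul_conj, Complex.normSq_eq_norm_sq]
  rw [e2, e2, hN] at e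
  exact_mod_cast e

end Fourier

/-! ### Gaussian integrals with a positive definite matrix -/

section RealGaussian

open scoped MatrixOrder in
-- With `M = Bᵀ B` the substitution `z ↦ B z` reduces Gaussian integrals for `M` to the isotropic
-- case.
theorem exists_eq_transpose_mul_self {κ : Type*} [Fintype κ] [DecidableEq κ] {M : Matrix κ κ ℝ}
    (hM : M.PosDef) : ∃ B : Matrix κ κ ℝ, B.det ≠ 0 ∧ M = Bᵀ * B := by
  obtain ⟨B, hB, h⟩ :=
    CStarAlgebra.isStrictlyPositive_iff_eq_star_mul_self.1 hM.isStrictlyPositive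
  refine ⟨B, ((Matrix.isUnit_iff_isUnit_det B).1 hB).ne_zero, ?_⟩
  rw [h, star_eq_conjTranspose, conjTranspose_eq_transpose_of_trivial]

variable {κ : Type} [Fintype κ]

theorem integrable_exp_neg_dotProduct_self {c : ℝ} (hc : 0 < c) :
    Integrable (fun z : κ → ℝ => Real.exp (-c * (z ⬝ᵥ z))) := by
  have h := Integrable.fintype_prod (f := fun (_ : κ) (v : ℝ) => Real.exp (-c * v ^ 2))
      (fun _ => integrable_exp_neg_mul_sq hc)
  refine h.congr (Filter.Eventually.of_forall fun z => ?_)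
  simp only [dotProduct, ← Real.exp_sum, Finset.mul_sum, pow_two]

theorem integral_exp_neg_dotProduct_self (c : ℝ) :
    ∫ z : κ → ℝ, Real.exp (-c * (z ⬝ᵥ z)) = √(Real.pi / c) ^ Fintype.card κ := by
  have h := integral_fintype_prod_volume_eq_prod (𝕜 := ℝ)
    (f := fun (_ : κ) (v : ℝ) => Real.exp (-c * v ^ 2))
  simp only [integral_gaussian, Finset.prod_const, Finset.card_univ] at h
  rw [← h]
  congr 1 with z
  simp only [dotProduct, ← Real.exp_sum, Finset.mul_sum, pow_two]

variable [DecidableEq κ]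

omit [DecidableEq κ] in
theorem quadratic_eq_of_eq_transpose_mul_self (B : Matrix κ κ ℝ) (z : κ → ℝ) :
    ((Bᵀ * B) *ᵥ z) ⬝ᵥ z = (B *ᵥ z) ⬝ᵥ (B *ᵥ z) := by
  rw [← mulVec_mulVec, mulVec_transpose, ← dotProduct_mulVec]

theorem integrable_exp_neg_quadratic {c : ℝ} (hc : 0 < c) {M : Matrix κ κ ℝ} (hM : M.PosDef) :
    Integrable (fun z : κ → ℝ => Real.exp (-c * ((M *ᵥ z) ⬝ᵥ z))) := by
  obtain ⟨B, hB, rfl⟩ := exists_eq_transpose_mul_self hM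
  have h := integrable_exp_neg_dotProduct_self (κ := κ) hc
  have hmap : Integrable (fun z : κ → ℝ => Real.exp (-c * (z ⬝ᵥ z)))
      (Measure.map (Matrix.toLin' B) volume) := by
    rw [Real.map_matrix_volume_pi_eq_smul_volume_pi hB]
    exact h.smul_measure ENNReal.ofReal_ne_top
  have hmeas : AEMeasurable (Matrix.toLin' B) (volume : Measure (κ → ℝ)) :=
    ((Matrix.toLin' B).continuous_of_finiteDimensional).aemeasurable
  refine (hmap.comp_aemeasurable hmeas).congr (Filter.Eventually.of_forall fun z => ?_)
  simp only [Function.comp, toLin'_apply, quadratic_eq_of_eq_transpose_mul_self]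

theorem integral_exp_neg_quadratic (c : ℝ) {M : Matrix κ κ ℝ} (hM : M.PosDef) :
    ∫ z : κ → ℝ, Real.exp (-c * ((M *ᵥ z) ⬝ᵥ z)) =
      √(Real.pi / c) ^ Fintype.card κ / √M.det := by
  obtain ⟨B, hB, rfl⟩ := exists_eq_transpose_mul_self hM
  have hmeas : AEMeasurable (Matrix.toLin' B) (volume : Measure (κ → ℝ)) :=
    ((Matrix.toLin' B).continuous_of_finiteDimensional).aemeasurable
  have hcont : Continuous (fun z : κ → ℝ => Real.exp (-c * (z ⬝ᵥ z))) := by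
    unfold dotProduct
    fun_prop
  have h := integral_map hmeas
    (hcont.aestronglyMeasurable (μ := Measure.map (Matrix.toLin' B) volume))
  rw [Real.map_matrix_volume_pi_eq_smul_volume_pi hB, integral_smul_measure,
    integral_exp_neg_dotProduct_self, ENNReal.toReal_ofReal (abs_nonneg _)] at h
  simp only [toLin'_apply] at h
  simp only [quadratic_eq_of_eq_transpose_mul_self]
  rw [← h, det_mul, det_transpose, Real.sqrt_mul_self_eq_abs, abs_inv, smul_eq_mul,
    div_eq_mul_inv _ |B.det|, mul_comm]

/-- Since `z = B⁻¹ (B z)`, a bound `C` for `B⁻¹` gives `|z|² ≤ C² |B z|²`; the constant is `C⁻²`. -/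
theorem exists_pos_mul_le_quadratic {M : Matrix κ κ ℝ} (hM : M.PosDef) :
    ∃ c : ℝ, 0 < c ∧ ∀ z : κ → ℝ, c * (z ⬝ᵥ z) ≤ (M *ᵥ z) ⬝ᵥ z := by
  obtain ⟨B, hB, rfl⟩ := exists_eq_transpose_mul_self hM
  obtain ⟨C, hC, h⟩ := (Matrix.toEuclideanLin B⁻¹).toContinuousLinearMap.bound
  refine ⟨(C ^ 2)⁻¹, by positivity, fun z => ?_⟩
  have h1 := h (WithLp.toLp 2 (B *ᵥ z))
  have h2 : (Matrix.toEuclideanLin B⁻¹).toContinuousLinearMap (WithLp.toLp 2 (B *ᵥ z)) =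
      WithLp.toLp 2 z := by
    simp [Matrix.toLpLin_toLp, mulVec_mulVec, nonsing_inv_mul _ (isUnit_iff_ne_zero.2 hB)]
  rw [h2] at h1
  have h3 := pow_le_pow_left₀ (norm_nonneg _) h1 2
  rw [mul_pow, EuclideanSpace.real_norm_sq_eq, EuclideanSpace.real_norm_sq_eq] at h3
  rw [quadratic_eq_of_eq_transpose_mul_self, inv_mul_le_iff₀ (by positivity)]
  simpa only [dotProduct, pow_two] using h3

end RealGaussian

/-! ### Completing the square and Schur complements -/

section SchurComplement

variable {μ ν : Type} [Fintype μ] [Fintype ν] [DecidableEq μ] [DecidableEq ν]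

omit [DecidableEq μ] in
-- Completion of the square in `y`: the remainder depends on `x` alone, through the Schur
-- complement.
theorem quadratic_sumElim {P : Matrix (μ ⊕ ν) (μ ⊕ ν) ℝ} (hP : P.PosDef) (x : μ → ℝ)
    (y : ν → ℝ) :
    (P *ᵥ Sum.elim x y) ⬝ᵥ Sum.elim x y =
      (P.toBlocks₂₂ *ᵥ (y + (P.toBlocks₂₂⁻¹ * P.toBlocks₂₁) *ᵥ x)) ⬝ᵥ
          (y + (P.toBlocks₂₂⁻¹ * P.toBlocks₂₁) *ᵥ x) +
        ((P.toBlocks₁₁ - P.toBlocks₁₂ * P.toBlocks₂₂⁻¹ * P.toBlocks₂₁) *ᵥ x) ⬝ᵥ x := by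
  have hD : P.toBlocks₂₂.PosDef := hP.submatrix (e := Sum.inr) Sum.inr_injective
  have hB : P.toBlocks₂₁ = P.toBlocks₁₂ᴴ := by
    ext i j
    simpa [toBlocks₂₁, toBlocks₁₂] using (hP.isHermitian.apply (Sum.inr i) (Sum.inl j)).symm
  have := hD.isUnit.invertible
  have h := schur_complement_eq₂₂ P.toBlocks₁₁ P.toBlocks₁₂ x y hD.isHermitian
  rw [← hB, fromBlocks_toBlocks] at h
  simp only [star_trivial, ← dotProduct_mulVec] at h
  rw [dotProduct_comm, h, dotProduct_comm x, add_comm y, dotProduct_comm]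

omit [DecidableEq μ] in
theorem posDef_schurComplement {P : Matrix (μ ⊕ ν) (μ ⊕ ν) ℝ} (hP : P.PosDef) :
    (P.toBlocks₁₁ - P.toBlocks₁₂ * P.toBlocks₂₂⁻¹ * P.toBlocks₂₁).PosDef := by
  have hD : P.toBlocks₂₂.PosDef := hP.submatrix (e := Sum.inr) Sum.inr_injective
  have hA : P.toBlocks₁₁.PosDef := hP.submatrix (e := Sum.inl) Sum.inl_injective
  have hB : P.toBlocks₂₁ = P.toBlocks₁₂ᴴ := by
    ext i j
    simpa [toBlocks₂₁, toBlocks₁₂] using (hP.isHermitian.apply (Sum.inr i) (Sum.inl j)).symm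
  refine PosDef.of_dotProduct_mulVec_pos ?_ fun {x} hx => ?_
  · rw [hB]
    exact hA.isHermitian.sub (isHermitian_mul_mul_conjTranspose _ hD.isHermitian.inv)
  -- This `y` makes the completed square vanish, so the Schur form at `x` is a value of the form of
  -- `P` at a nonzero vector.
  · have h := quadratic_sumElim hP x (-((P.toBlocks₂₂⁻¹ * P.toBlocks₂₁) *ᵥ x))
    rw [neg_add_cancel, dotProduct_zero, zero_add] at h
    rw [star_trivial, dotProduct_comm, ← h, dotProduct_comm]
    refine hP.dotProduct_mulVec_pos fun h0 => hx ?_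
    ext i
    exact congrFun h0 (Sum.inl i)

theorem det_eq_mul_det_schurComplement {P : Matrix (μ ⊕ ν) (μ ⊕ ν) ℝ} (hP : P.PosDef) :
    P.det = P.toBlocks₂₂.det *
      (P.toBlocks₁₁ - P.toBlocks₁₂ * P.toBlocks₂₂⁻¹ * P.toBlocks₂₁).det := by
  have hD : P.toBlocks₂₂.PosDef := hP.submatrix (e := Sum.inr) Sum.inr_injective
  have := hD.isUnit.invertible
  conv_lhs => rw [← fromBlocks_toBlocks P, det_fromBlocks₂₂, invOf_eq_nonsing_inv]

end SchurComplement

/-! ### Gaussians on phase space -/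

section PhaseGaussian

variable {ι : Type} [Fintype ι] [DecidableEq ι]

theorem continuous_phaseGaussian (ħ : ℝ) (M : Matrix (ι ⊕ ι) (ι ⊕ ι) ℝ) (c : Phase ι) :
    Continuous (phaseGaussian ħ M c) := by
  unfold phaseGaussian dotProduct
  fun_prop

theorem phaseGaussian_nonneg {ħ : ℝ} (hħ : 0 < ħ) (M : Matrix (ι ⊕ ι) (ι ⊕ ι) ℝ)
    (c z : Phase ι) : 0 ≤ phaseGaussian ħ M c z := by
  unfold phaseGaussian
  positivity

theorem phaseGaussian_sq (ħ : ℝ) (M : Matrix (ι ⊕ ι) (ι ⊕ ι) ℝ) (c z : Phase ι) :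
    phaseGaussian ħ M c z ^ 2 = (((Real.pi * ħ) ^ (Fintype.card ι))⁻¹ * √M.det) ^ 2 *
      Real.exp (-(2 / ħ) * ((M *ᵥ (z - c)) ⬝ᵥ (z - c))) := by
  rw [phaseGaussian, mul_pow, ← Real.exp_nat_mul]
  congr 2
  push_cast
  ring

theorem integrable_sq_phaseGaussian {ħ : ℝ} (hħ : 0 < ħ) {M : Matrix (ι ⊕ ι) (ι ⊕ ι) ℝ}
    (hM : M.PosDef) (c : Phase ι) : Integrable (fun z => phaseGaussian ħ M c z ^ 2) := by
  simp_rw [phaseGaussian_sq]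
  exact ((integrable_exp_neg_quadratic (by positivity : 0 < 2 / ħ) hM).comp_sub_right c).const_mul _

theorem integral_sq_phaseGaussian {ħ : ℝ} (hħ : 0 < ħ) {M : Matrix (ι ⊕ ι) (ι ⊕ ι) ℝ}
    (hM : M.PosDef) (c : Phase ι) :
    ∫ z, phaseGaussian ħ M c z ^ 2 = ((2 * Real.pi * ħ) ^ Fintype.card ι)⁻¹ * √M.det := by
  simp_rw [phaseGaussian_sq]
  -- Phase space has dimension `card ι + card ι`, so the square roots from the Gaussian integral
  -- pair up to integral powers.
  rw [integral_const_mul, integral_sub_right_eq_self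
    (fun z => Real.exp (-(2 / ħ) * ((M *ᵥ z) ⬝ᵥ z))), integral_exp_neg_quadratic _ hM, Fintype.card_sum, pow_add, ← mul_pow, Real.mul_self_sqrt (by positivity)]
  have hd : √M.det ≠ 0 := (Real.sqrt_pos.2 hM.det_pos).ne'
  have e : Real.pi / (2 / ħ) = (Real.pi * ħ) * (Real.pi * ħ) / (2 * Real.pi * ħ) := by
    field_simp
  rw [e, div_pow, mul_pow (Real.pi * ħ)]
  field_simp

/-- A dominating function that factors over positions and momenta, for the uses of Fubini and of
dominated convergence. -/
theorem exists_phaseGaussian_le {ħ : ℝ} (hħ : 0 < ħ) {M : Matrix (ι ⊕ ι) (ι ⊕ ι) ℝ}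
    (hM : M.PosDef) (c : Phase ι) : ∃ C b : ℝ, 0 < b ∧ 0 ≤ C ∧
      ∀ z, phaseGaussian ħ M c z ≤ C * (Real.exp (-b * ((pos z - pos c) ⬝ᵥ (pos z - pos c))) *
        Real.exp (-b * ((mom z - mom c) ⬝ᵥ (mom z - mom c)))) := by
  obtain ⟨b, hb, h⟩ := exists_pos_mul_le_quadratic hM
  refine ⟨((Real.pi * ħ) ^ (Fintype.card ι))⁻¹ * √M.det, b / ħ, by positivity, by positivity,
    fun z => ?_⟩
  rw [phaseGaussian, ← Real.exp_add]
  gcongr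
  have h1 := h (z - c)
  have h2 : (z - c) ⬝ᵥ (z - c) = (pos z - pos c) ⬝ᵥ (pos z - pos c) +
      (mom z - mom c) ⬝ᵥ (mom z - mom c) := by
    simp [dotProduct, pos, mom]
  rw [h2] at h1
  have h3 := mul_le_mul_of_nonneg_left h1 (one_div_pos.2 hħ).le
  have h4 : 1 / ħ * (b * ((pos z - pos c) ⬝ᵥ (pos z - pos c) +
      (mom z - mom c) ⬝ᵥ (mom z - mom c))) = b / ħ * ((pos z - pos c) ⬝ᵥ (pos z - pos c)) +
      b / ħ * ((mom z - mom c) ⬝ᵥ (mom z - mom c)) := by ring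
  linarith

end PhaseGaussian

/-! ### Marginals over the subsystem `B` -/

section Marginal

variable {α β : Type} [Fintype α] [Fintype β] [DecidableEq α] [DecidableEq β]
  {P : Matrix ((α ⊕ β) ⊕ (α ⊕ β)) ((α ⊕ β) ⊕ (α ⊕ β)) ℝ}

omit [Fintype α] [Fintype β] [DecidableEq α] [DecidableEq β] in
theorem posDef_bipartite (hP : P.PosDef) : (bipartite P).PosDef :=
  hP.submatrix (Equiv.injective _)

omit [Fintype α] [Fintype β] [DecidableEq α] [DecidableEq β] in
theorem posDef_blockBB (hP : P.PosDef) : (blockBB P).PosDef :=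
  (posDef_bipartite hP).submatrix (e := Sum.inr) Sum.inr_injective

omit [DecidableEq α] in
theorem posDef_schurA (hP : P.PosDef) : (schurA P).PosDef :=
  posDef_schurComplement (posDef_bipartite hP)

theorem det_eq_det_blockBB_mul_det_schurA (hP : P.PosDef) :
    P.det = (blockBB P).det * (schurA P).det := by
  rw [blockBB, schurA, blockBB, ← det_eq_mul_det_schurComplement (posDef_bipartite hP), bipartite,
    det_submatrix_equiv_self]

omit [DecidableEq α] [DecidableEq β] in
theorem quadratic_joinAB (P : Matrix ((α ⊕ β) ⊕ (α ⊕ β)) ((α ⊕ β) ⊕ (α ⊕ β)) ℝ)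
    (u : Phase α) (v : Phase β) :
    (P *ᵥ joinAB u v) ⬝ᵥ joinAB u v = (bipartite P *ᵥ Sum.elim u v) ⬝ᵥ Sum.elim u v := by
  have h : joinAB u v = Sum.elim u v ∘ (Equiv.sumSumSumComm α α β β).symm := by
    ext i
    rcases i with (i | i) | (i | i) <;> rfl
  rw [bipartite, submatrix_mulVec_equiv, h, ← comp_equiv_symm_dotProduct, Equiv.symm_symm]

/-- The `B`-component of a phase space point. -/
def projB (z : Phase (α ⊕ β)) : Phase β :=
  Sum.elim (fun b => z (Sum.inl (Sum.inr b))) (fun b => z (Sum.inr (Sum.inr b)))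

/-- The `B` variable enters only through a Gaussian with matrix `P_BB`, whose center is shifted by
an amount depending on `u`; translation invariance will remove the shift. -/
theorem phaseGaussian_joinAB (ħ : ℝ) (hP : P.PosDef) (c : Phase (α ⊕ β)) (u : Phase α)
    (v : Phase β) :
    phaseGaussian ħ P c (joinAB u v) =
      ((Real.pi * ħ) ^ (Fintype.card (α ⊕ β)))⁻¹ * √P.det *
        Real.exp (-(1 / ħ) * ((schurA P *ᵥ (u - projA c)) ⬝ᵥ (u - projA c))) *
        Real.exp (-(1 / ħ) * ((blockBB P *ᵥ (v - (projB c -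
          ((blockBB P)⁻¹ * (bipartite P).toBlocks₂₁) *ᵥ (u - projA c)))) ⬝ᵥ
          (v - (projB c - ((blockBB P)⁻¹ * (bipartite P).toBlocks₂₁) *ᵥ (u - projA c))))) := by
  have h : joinAB u v - c = joinAB (u - projA c) (v - projB c) := by
    ext i
    rcases i with (i | i) | (i | i) <;> rfl
  rw [phaseGaussian, h, quadratic_joinAB, quadratic_sumElim (posDef_bipartite hP),
    mul_assoc _ (Real.exp _), ← Real.exp_add]
  congr 2
  rw [mul_add, add_comm, sub_sub_eq_add_sub, add_sub_right_comm]
  rfl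

theorem integrable_phaseGaussian_joinAB {ħ : ℝ} (hħ : 0 < ħ) (hP : P.PosDef)
    (c : Phase (α ⊕ β)) (u : Phase α) :
    Integrable (fun v : Phase β => phaseGaussian ħ P c (joinAB u v)) := by
  simp_rw [phaseGaussian_joinAB ħ hP]
  exact ((integrable_exp_neg_quadratic (one_div_pos.2 hħ) (posDef_blockBB hP)).comp_sub_right
    _).const_mul _

/-- Marginals of Gaussians on phase space are Gaussian, with matrix the Schur complement. -/
theorem integral_phaseGaussian_joinAB {ħ : ℝ} (hħ : 0 < ħ) (hP : P.PosDef)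
    (c : Phase (α ⊕ β)) (u : Phase α) :
    ∫ v : Phase β, phaseGaussian ħ P c (joinAB u v) =
      phaseGaussian ħ (schurA P) (projA c) u := by
  simp_rw [phaseGaussian_joinAB ħ hP]
  rw [integral_const_mul, integral_sub_right_eq_self
    (fun v => Real.exp (-(1 / ħ) * ((blockBB P *ᵥ v) ⬝ᵥ v))),
    integral_exp_neg_quadratic _ (posDef_blockBB hP), phaseGaussian,
    det_eq_det_blockBB_mul_det_schurA hP, Real.sqrt_mul (posDef_blockBB hP).det_pos.le,
    Fintype.card_sum, Fintype.card_sum, pow_add _ (Fintype.card β), ← mul_pow,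
    Real.mul_self_sqrt (by positivity), pow_add]
  have hd : √(blockBB P).det ≠ 0 := (Real.sqrt_pos.2 (posDef_blockBB hP).det_pos).ne'
  field_simp

end Marginal

/-! ### Integral operators with square integrable kernel -/

section KernelOperator

theorem HilbertBasis.hasSum_norm_inner_sq {κ E : Type*} [NormedAddCommGroup E]
    [InnerProductSpace ℂ E] (b : HilbertBasis κ ℂ E) (v : E) :
    HasSum (fun k => ‖⟪v, b k⟫_ℂ‖ ^ 2) (‖v‖ ^ 2) := by
  have h := (b.hasSum_inner_mul_inner v v).mapL Complex.reCLM
  have e : Complex.reCLM ⟪v, v⟫_ℂ = ‖v‖ ^ 2 := by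
    rw [inner_self_eq_norm_sq_to_K]
    norm_cast
  rw [e] at h
  refine h.congr_fun fun k => ?_
  rw [← inner_conj_symm (b k) v, Complex.mul_conj, Complex.normSq_eq_norm_sq]
  norm_cast

/-- Distinct basis vectors are at distance `√2`, so the balls of radius `1/2` around them are
disjoint open sets. Countability permits exchanging the sum over a basis with an integral. -/
theorem HilbertBasis.countable {κ E : Type*} [NormedAddCommGroup E] [InnerProductSpace ℂ E]
    [TopologicalSpace.SeparableSpace E] (b : HilbertBasis κ ℂ E) : Countable κ := by
  refine Pairwise.countable_of_isOpen_disjoint (s := fun k => Metric.ball (b k) (1 / 2)) ?_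
    (fun k => Metric.isOpen_ball) (fun k => ⟨b k, Metric.mem_ball_self (by norm_num)⟩)
  intro j k hjk
  refine Metric.ball_disjoint_ball ?_
  have h0 : ⟪b j, b k⟫_ℂ = 0 := b.orthonormal.2 hjk
  have h1 : ‖b j - b k‖ ^ 2 = 2 := by
    rw [@norm_sub_sq ℂ, h0, b.orthonormal.1, b.orthonormal.1]
    norm_num
  rw [dist_eq_norm]
  nlinarith [norm_nonneg (b j - b k)]

variable {α β : Type} [Fintype α] [Fintype β]

/-- The square integrable kernels on `(α → ℝ) × (β → ℝ)`. -/
abbrev IsL2Kernel (k : (α → ℝ) × (β → ℝ) → ℂ) : Prop :=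
  MemLp k 2 ((volume : Measure (α → ℝ)).prod (volume : Measure (β → ℝ)))

/-- The adjoint kernel. -/
def adjointKernel (k : (α → ℝ) × (β → ℝ) → ℂ) (q : (β → ℝ) × (α → ℝ)) : ℂ := conj (k q.swap)

theorem IsL2Kernel.adjoint {k : (α → ℝ) × (β → ℝ) → ℂ} (hk : IsL2Kernel k) :
    IsL2Kernel (adjointKernel k) :=
  (hk.comp_measurePreserving Measure.measurePreserving_swap).star

open Classical in
/-- The conjugated row `y ↦ conj (k (x, y))` of a kernel. -/
noncomputable def kernelRow (k : (α → ℝ) × (β → ℝ) → ℂ) (x : α → ℝ) : L2 β :=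
  -- The conjugate compensates for the inner product being antilinear on the left. For a square
  -- integrable kernel the default `0` is taken only on a null set of rows.
  if h : MemLp (fun y => conj (k (x, y))) 2 volume then h.toLp _ else 0

variable {k : (α → ℝ) × (β → ℝ) → ℂ}

theorem IsL2Kernel.memLp_row (hk : IsL2Kernel k) :
    ∀ᵐ x : α → ℝ, MemLp (fun y => k (x, y)) 2 volume := by
  have h := ((memLp_two_iff_integrable_sq_norm hk.1).1 hk).prod_right_ae
  filter_upwards [h, hk.1.prodMk_left] with x h1 h2
  exact (memLp_two_iff_integrable_sq_norm h2).2 h1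

theorem IsL2Kernel.kernelRow_coeFn (hk : IsL2Kernel k) :
    ∀ᵐ x : α → ℝ, (kernelRow k x : (β → ℝ) → ℂ) =ᵐ[volume] fun y => conj (k (x, y)) := by
  filter_upwards [hk.memLp_row] with x h
  have h' : MemLp (fun y => conj (k (x, y))) 2 volume := h.star
  rw [kernelRow, dif_pos h']
  exact h'.coeFn_toLp

theorem IsL2Kernel.inner_kernelRow (hk : IsL2Kernel k) (f : L2 β) :
    (fun x => ⟪kernelRow k x, f⟫_ℂ) =ᵐ[volume] fun x => ∫ y, k (x, y) * f y := by
  filter_upwards [hk.kernelRow_coeFn] with x h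
  rw [L2.inner_def]
  refine integral_congr_ae ?_
  filter_upwards [h] with y hy
  rw [RCLike.inner_apply, hy, Complex.conj_conj, mul_comm]

theorem L2.norm_sq_eq_integral (f : L2 β) : ‖f‖ ^ 2 = ∫ y, ‖f y‖ ^ 2 := by
  have h : ∀ {E : Type} [NormedAddCommGroup E] [InnerProductSpace ℂ E] (v : E),
      ⟪v, v⟫_ℂ = ((‖v‖ ^ 2 : ℝ) : ℂ) := fun v => by
    rw [inner_self_eq_norm_sq_to_K]
    norm_cast
  have h1 := h f
  rw [MeasureTheory.L2.inner_def] at h1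
  simp_rw [h] at h1
  rw [integral_complex_ofReal] at h1
  exact (Complex.ofReal_injective h1).symm

theorem IsL2Kernel.norm_kernelRow_sq (hk : IsL2Kernel k) :
    (fun x => ‖kernelRow k x‖ ^ 2) =ᵐ[volume] fun x => ∫ y, ‖k (x, y)‖ ^ 2 := by
  filter_upwards [hk.kernelRow_coeFn] with x h
  rw [L2.norm_sq_eq_integral]
  refine integral_congr_ae ?_
  filter_upwards [h] with y hy
  rw [hy, RCLike.norm_conj]

theorem IsL2Kernel.integrable_norm_kernelRow_sq (hk : IsL2Kernel k) :
    Integrable (fun x => ‖kernelRow k x‖ ^ 2) :=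
  ((memLp_two_iff_integrable_sq_norm hk.1).1 hk).integral_prod_left.congr
    hk.norm_kernelRow_sq.symm

theorem IsL2Kernel.integral_norm_kernelRow_sq (hk : IsL2Kernel k) :
    ∫ x, ‖kernelRow k x‖ ^ 2 = ∫ q, ‖k q‖ ^ 2 ∂(volume.prod volume) := by
  rw [integral_prod _ ((memLp_two_iff_integrable_sq_norm hk.1).1 hk)]
  exact integral_congr_ae hk.norm_kernelRow_sq

theorem IsL2Kernel.aestronglyMeasurable_inner (hk : IsL2Kernel k) (f : L2 β) :
    AEStronglyMeasurable (fun x => ⟪kernelRow k x, f⟫_ℂ) volume := by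
  refine AEStronglyMeasurable.congr ?_ (hk.inner_kernelRow f).symm
  exact (hk.1.mul (Lp.aestronglyMeasurable f).comp_snd).integral_prod_right'

theorem IsL2Kernel.integrable_norm_inner_sq (hk : IsL2Kernel k) (f : L2 β) :
    Integrable (fun x => ‖⟪kernelRow k x, f⟫_ℂ‖ ^ 2) := by
  refine (hk.integrable_norm_kernelRow_sq.mul_const (‖f‖ ^ 2)).mono'
    ((hk.aestronglyMeasurable_inner f).norm.pow 2) (Filter.Eventually.of_forall fun x => ?_)
  rw [norm_pow, norm_norm, ← mul_pow]
  exact pow_le_pow_left₀ (norm_nonneg _) (norm_inner_le_norm _ _) 2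

theorem IsL2Kernel.memLp_inner (hk : IsL2Kernel k) (f : L2 β) :
    MemLp (fun x => ⟪kernelRow k x, f⟫_ℂ) 2 volume :=
  (memLp_two_iff_integrable_sq_norm (hk.aestronglyMeasurable_inner f)).2
    (hk.integrable_norm_inner_sq f)

/-- The integral operator with a square integrable kernel, as a linear map. -/
noncomputable def kernelOpₗ (k : (α → ℝ) × (β → ℝ) → ℂ) (hk : IsL2Kernel k) :
    L2 β →ₗ[ℂ] L2 α where
  toFun f := (hk.memLp_inner f).toLp _
  map_add' f g := by
    rw [← MemLp.toLp_add]
    refine MemLp.toLp_congr _ _ (Filter.Eventually.of_forall fun x => ?_)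
    exact inner_add_right _ _ _
  map_smul' c f := by
    rw [RingHom.id_apply, ← MemLp.toLp_const_smul]
    refine MemLp.toLp_congr _ _ (Filter.Eventually.of_forall fun x => ?_)
    exact inner_smul_right _ _ _

theorem kernelOpₗ_coeFn (hk : IsL2Kernel k) (f : L2 β) :
    (kernelOpₗ k hk f : (α → ℝ) → ℂ) =ᵐ[volume] fun x => ⟪kernelRow k x, f⟫_ℂ :=
  (hk.memLp_inner f).coeFn_toLp

theorem norm_kernelOpₗ_sq (hk : IsL2Kernel k) (f : L2 β) :
    ‖kernelOpₗ k hk f‖ ^ 2 = ∫ x, ‖⟪kernelRow k x, f⟫_ℂ‖ ^ 2 := by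
  rw [L2.norm_sq_eq_integral]
  refine integral_congr_ae ?_
  filter_upwards [kernelOpₗ_coeFn hk f] with x h
  rw [h]

/-- The integral operator with a square integrable kernel. -/
noncomputable def kernelOp (k : (α → ℝ) × (β → ℝ) → ℂ) (hk : IsL2Kernel k) :
    L2 β →L[ℂ] L2 α :=
  (kernelOpₗ k hk).mkContinuous (√(∫ x, ‖kernelRow k x‖ ^ 2)) fun f => by
    -- Cauchy-Schwarz on each row bounds the operator by the `L²` norm of its kernel.
    rw [← pow_le_pow_iff_left₀ (norm_nonneg _) (by positivity) two_ne_zero]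
    rw [norm_kernelOpₗ_sq, mul_pow, Real.sq_sqrt (integral_nonneg fun _ => by positivity),
      ← integral_mul_const]
    refine integral_mono (hk.integrable_norm_inner_sq f)
      (hk.integrable_norm_kernelRow_sq.mul_const _) fun x => ?_
    simp only []
    rw [← mul_pow]
    exact pow_le_pow_left₀ (norm_nonneg _) (norm_inner_le_norm _ _) 2

theorem kernelOp_coeFn (hk : IsL2Kernel k) (f : L2 β) :
    (kernelOp k hk f : (α → ℝ) → ℂ) =ᵐ[volume] fun x => ∫ y, k (x, y) * f y :=
  (kernelOpₗ_coeFn hk f).trans (hk.inner_kernelRow f)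

theorem norm_kernelOp_sq (hk : IsL2Kernel k) (f : L2 β) :
    ‖kernelOp k hk f‖ ^ 2 = ∫ x, ‖⟪kernelRow k x, f⟫_ℂ‖ ^ 2 :=
  norm_kernelOpₗ_sq hk f

/-- The Hilbert-Schmidt norm of an integral operator is the `L²` norm of its kernel. -/
theorem hasSum_norm_kernelOp_sq (hk : IsL2Kernel k) {κ : Type*} (b : HilbertBasis κ ℂ (L2 β)) :
    HasSum (fun j => ‖kernelOp k hk (b j)‖ ^ 2) (∫ q, ‖k q‖ ^ 2 ∂(volume.prod volume)) := by
  have : Fact ((2 : ENNReal) ≠ ⊤) := ⟨by norm_num⟩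
  have := HilbertBasis.countable b
  -- Parseval on each row gives `∑ⱼ |⟪k_x, bⱼ⟫|² = ‖k_x‖²`; this is integrated over `x`.
  have h := hasSum_integral_of_summable_integral_norm
    (F := fun j x => ‖⟪kernelRow k x, b j⟫_ℂ‖ ^ 2) (μ := (volume : Measure (α → ℝ)))
    (fun j => hk.integrable_norm_inner_sq (b j)) ?_
  · simp only [(HilbertBasis.hasSum_norm_inner_sq b _).tsum_eq,
      hk.integral_norm_kernelRow_sq] at h
    simpa only [norm_kernelOp_sq] using h
  · refine summable_of_sum_le (c := ∫ x, ‖kernelRow k x‖ ^ 2)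
      (fun j => integral_nonneg fun x => by positivity) fun s => ?_
    simp only [norm_pow, norm_norm]
    rw [← integral_finsetSum _ fun j _ => hk.integrable_norm_inner_sq (b j)]
    refine integral_mono (integrable_finsetSum _ fun j _ => hk.integrable_norm_inner_sq (b j))
      hk.integrable_norm_kernelRow_sq fun x => ?_
    exact sum_le_hasSum s (fun j _ => by positivity)
      (HilbertBasis.hasSum_norm_inner_sq b (kernelRow k x))

theorem memLp_prod_mul (f : L2 α) (g : L2 β) :
    MemLp (fun q : (α → ℝ) × (β → ℝ) => f q.1 * g q.2) 2 (volume.prod volume) := by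
  have hf := Lp.memLp f
  have hg := Lp.memLp g
  have hm : AEStronglyMeasurable (fun q : (α → ℝ) × (β → ℝ) => f q.1 * g q.2)
      (volume.prod volume) :=
    (hf.1.comp_fst).mul (hg.1.comp_snd)
  rw [memLp_two_iff_integrable_sq_norm hm]
  have := ((memLp_two_iff_integrable_sq_norm hf.1).1 hf).mul_prod
    ((memLp_two_iff_integrable_sq_norm hg.1).1 hg)
  simpa only [norm_mul, mul_pow] using this

theorem IsL2Kernel.integrable_mul (hk : IsL2Kernel k) (f : L2 α) (g : L2 β) :
    Integrable (fun q : (α → ℝ) × (β → ℝ) => conj (k q) * (f q.1 * g q.2))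
      (volume.prod volume) :=
  MemLp.integrable_mul (p := 2) (q := 2) hk.star (memLp_prod_mul f g)

theorem kernelOp_adjointKernel_coeFn (hk : IsL2Kernel k) (f : L2 α) :
    (kernelOp (adjointKernel k) hk.adjoint f : (β → ℝ) → ℂ) =ᵐ[volume]
      fun y => ∫ x, conj (k (x, y)) * f x :=
  kernelOp_coeFn hk.adjoint f

/-- Fubini with `x` integrated first; `integral_conj_kernel_mul'` takes the other order, and
comparing the two gives the adjoint. -/
theorem integral_conj_kernel_mul (hk : IsL2Kernel k) (f : L2 α) (g : L2 β) :
    ∫ q, conj (k q) * (f q.1 * g q.2) ∂(volume.prod volume) =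
      ∫ y, (kernelOp (adjointKernel k) hk.adjoint f : (β → ℝ) → ℂ) y * g y := by
  rw [integral_prod_symm _ (hk.integrable_mul f g)]
  refine integral_congr_ae ?_
  filter_upwards [kernelOp_adjointKernel_coeFn hk f] with y hy
  rw [hy, ← integral_mul_const]
  simp only [mul_assoc]

theorem integral_conj_kernel_mul' (hk : IsL2Kernel k) (f : L2 α) (g : L2 β) :
    ∫ q, conj (k q) * (f q.1 * conj (g q.2)) ∂(volume.prod volume) =
      ∫ x, f x * conj ((kernelOp k hk g : (α → ℝ) → ℂ) x) := by
  have hi : Integrable (fun q : (α → ℝ) × (β → ℝ) => conj (k q) * (f q.1 * conj (g q.2)))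
      (volume.prod volume) := by
    refine (hk.integrable_mul f (star g)).congr ?_
    have h := Measure.quasiMeasurePreserving_snd (μ := (volume : Measure (α → ℝ)))
      (ν := (volume : Measure (β → ℝ))) |>.ae (Lp.coeFn_star g)
    filter_upwards [h] with q hq
    rw [hq]
    rfl
  rw [integral_prod _ hi]
  refine integral_congr_ae ?_
  filter_upwards [kernelOp_coeFn hk g] with x hx
  rw [hx, ← integral_conj, ← integral_const_mul]
  congr 1 with y
  rw [map_mul]
  ring

/-- The adjoint of an integral operator is the integral operator with the adjoint kernel. -/
theorem adjoint_kernelOp (hk : IsL2Kernel k) :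
    ContinuousLinearMap.adjoint (kernelOp k hk) = kernelOp (adjointKernel k) hk.adjoint := by
  refine ((ContinuousLinearMap.eq_adjoint_iff _ _).2 fun f g => ?_).symm
  have h2 := integral_conj_kernel_mul hk f (star g)
  have h3 : ∫ q, conj (k q) * (f q.1 * (star g : L2 β) q.2) ∂(volume.prod volume) =
      ∫ q, conj (k q) * (f q.1 * conj (g q.2)) ∂(volume.prod volume) := by
    refine integral_congr_ae ?_
    have h := Measure.quasiMeasurePreserving_snd (μ := (volume : Measure (α → ℝ)))
      (ν := (volume : Measure (β → ℝ))) |>.ae (Lp.coeFn_star g)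
    filter_upwards [h] with q hq
    rw [hq]
    rfl
  rw [h3, integral_conj_kernel_mul' hk f g] at h2
  have h4 := congrArg conj h2
  rw [← integral_conj, ← integral_conj] at h4
  rw [L2.inner_def, L2.inner_def]
  refine Eq.trans ?_ (h4.symm.trans ?_)
  · refine integral_congr_ae ?_
    filter_upwards [Lp.coeFn_star g] with y hy
    rw [hy, RCLike.inner_apply, map_mul, Pi.star_apply, RCLike.star_def, Complex.conj_conj,
      mul_comm]
  · congr 1 with x
    rw [RCLike.inner_apply, map_mul, Complex.conj_conj, mul_comm]

/-- The kernel of `T_k T_k†`. -/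
noncomputable def selfAdjointKernel (k : (α → ℝ) × (β → ℝ) → ℂ)
    (q : (α → ℝ) × (α → ℝ)) : ℂ :=
  ∫ y, k (q.1, y) * conj (k (q.2, y))

theorem IsL2Kernel.aestronglyMeasurable_selfAdjointKernel (hk : IsL2Kernel k) :
    AEStronglyMeasurable (fun r : ((α → ℝ) × (α → ℝ)) × (β → ℝ) =>
      k (r.1.1, r.2) * conj (k (r.1.2, r.2))) ((volume.prod volume).prod volume) := by
  have h1 : Measure.QuasiMeasurePreserving
      (fun r : ((α → ℝ) × (α → ℝ)) × (β → ℝ) => (r.1.1, r.2))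
      ((volume.prod volume).prod volume) (volume.prod volume) :=
    MeasureTheory.QuasiMeasurePreserving.prodMap Measure.quasiMeasurePreserving_fst
      (Measure.QuasiMeasurePreserving.id _)
  have h2 : Measure.QuasiMeasurePreserving
      (fun r : ((α → ℝ) × (α → ℝ)) × (β → ℝ) => (r.1.2, r.2))
      ((volume.prod volume).prod volume) (volume.prod volume) :=
    MeasureTheory.QuasiMeasurePreserving.prodMap Measure.quasiMeasurePreserving_snd
      (Measure.QuasiMeasurePreserving.id _)
  exact (hk.1.comp_quasiMeasurePreserving h1).mul
    (hk.1.comp_quasiMeasurePreserving h2).star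

/-- As a Gram matrix of the rows, the kernel is bounded by a product of row norms, which makes it
square integrable. -/
theorem IsL2Kernel.selfAdjointKernel_ae_eq_inner (hk : IsL2Kernel k) :
    ∀ᵐ q : (α → ℝ) × (α → ℝ) ∂(volume.prod volume),
      selfAdjointKernel k q = ⟪kernelRow k q.1, kernelRow k q.2⟫_ℂ := by
  have h1 := Measure.quasiMeasurePreserving_fst (μ := (volume : Measure (α → ℝ)))
    (ν := (volume : Measure (α → ℝ))) |>.ae hk.kernelRow_coeFn
  have h2 := Measure.quasiMeasurePreserving_snd (μ := (volume : Measure (α → ℝ)))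
    (ν := (volume : Measure (α → ℝ))) |>.ae hk.kernelRow_coeFn
  filter_upwards [h1, h2] with q h1 h2
  rw [L2.inner_def, selfAdjointKernel]
  refine integral_congr_ae ?_
  filter_upwards [h1, h2] with y h1 h2
  rw [RCLike.inner_apply, h1, h2, Complex.conj_conj, mul_comm]

theorem IsL2Kernel.selfAdjointKernel (hk : IsL2Kernel k) :
    IsL2Kernel (selfAdjointKernel k) := by
  have hm : AEStronglyMeasurable (ThawedGaussian.selfAdjointKernel k) (volume.prod volume) :=
    hk.aestronglyMeasurable_selfAdjointKernel.integral_prod_right'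
  refine (memLp_two_iff_integrable_sq_norm hm).2 ?_
  refine (hk.integrable_norm_kernelRow_sq.mul_prod hk.integrable_norm_kernelRow_sq).mono'
    (hm.norm.pow 2) ?_
  filter_upwards [hk.selfAdjointKernel_ae_eq_inner] with q hq
  rw [norm_pow, norm_norm, hq, ← mul_pow]
  exact pow_le_pow_left₀ (norm_nonneg _) (norm_inner_le_norm _ _) 2

/-- For almost every `x` the row `k(x, ·)` is itself in `L²`, so the pairing formula for the adjoint
applies with that row as test function. -/
theorem kernelOp_comp_adjoint (hk : IsL2Kernel k) :
    kernelOp k hk ∘L ContinuousLinearMap.adjoint (kernelOp k hk) =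
      kernelOp (selfAdjointKernel k) hk.selfAdjointKernel := by
  ext1 f
  apply Lp.ext
  rw [ContinuousLinearMap.comp_apply, adjoint_kernelOp]
  filter_upwards [kernelOp_coeFn hk (kernelOp (adjointKernel k) hk.adjoint f),
    kernelOp_coeFn hk.selfAdjointKernel f, hk.memLp_row] with x h1 h2 h3
  rw [h1, h2]
  have hi : Integrable (fun q : (α → ℝ) × (β → ℝ) =>
      conj (k q) * (f q.1 * h3.toLp _ q.2)) (volume.prod volume) :=
    hk.integrable_mul f (h3.toLp _)
  have h4 := integral_conj_kernel_mul hk f (h3.toLp _)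
  rw [integral_prod _ hi] at h4
  calc ∫ y, k (x, y) * (kernelOp (adjointKernel k) hk.adjoint f : (β → ℝ) → ℂ) y
      = ∫ y, (kernelOp (adjointKernel k) hk.adjoint f : (β → ℝ) → ℂ) y * h3.toLp _ y := by
        refine integral_congr_ae ?_
        filter_upwards [h3.coeFn_toLp] with y hy
        rw [hy, mul_comm]
    _ = ∫ x', ∫ y, conj (k (x', y)) * (f x' * h3.toLp _ y) := h4.symm
    _ = ∫ x', ThawedGaussian.selfAdjointKernel k (x, x') * f x' := by
        congr 1 with x'
        rw [ThawedGaussian.selfAdjointKernel, ← integral_mul_const]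
        refine integral_congr_ae ?_
        filter_upwards [h3.coeFn_toLp] with y hy
        simp only [hy]
        ring

/-- The diagonal elements of `T T†` are `‖T† bⱼ‖²`, whose sum is the Hilbert-Schmidt norm squared of
the adjoint kernel. -/
theorem isTrace_kernelOp_comp_adjoint (hk : IsL2Kernel k) :
    IsTrace (kernelOp k hk ∘L ContinuousLinearMap.adjoint (kernelOp k hk))
      ((∫ q, ‖k q‖ ^ 2 ∂(volume.prod volume) : ℝ) : ℂ) := by
  intro κ b
  have h := (hasSum_norm_kernelOp_sq hk.adjoint b).mapL Complex.ofRealCLM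
  have e : ∫ q, ‖adjointKernel k q‖ ^ 2 ∂(volume.prod volume) =
      ∫ q, ‖k q‖ ^ 2 ∂(volume.prod volume) := by
    simp only [adjointKernel, RCLike.norm_conj]
    exact integral_prod_swap (fun q => ‖k q‖ ^ 2)
  rw [e] at h
  refine h.congr_fun fun j => ?_
  rw [ContinuousLinearMap.comp_apply, ← ContinuousLinearMap.adjoint_inner_left,
    adjoint_kernelOp, inner_self_eq_norm_sq_to_K]
  norm_cast

theorem isDensityOperator_kernelOp_comp_adjoint (hk : IsL2Kernel k)
    (h1 : ∫ q, ‖k q‖ ^ 2 ∂(volume.prod volume) = 1) :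
    IsDensityOperator (kernelOp k hk ∘L ContinuousLinearMap.adjoint (kernelOp k hk)) where
  positive := ContinuousLinearMap.isPositive_self_comp_adjoint _
  trace_one := by simpa [h1] using isTrace_kernelOp_comp_adjoint hk

theorem hasKernel_kernelOp_comp_adjoint (hk : IsL2Kernel k) :
    HasKernel (kernelOp k hk ∘L ContinuousLinearMap.adjoint (kernelOp k hk))
      (fun x x' => selfAdjointKernel k (x, x')) where
  memLp := hk.selfAdjointKernel
  apply f := by
    rw [kernelOp_comp_adjoint]
    exact kernelOp_coeFn _ f

/-- `R = T T†` is self-adjoint and again an integral operator, so `R² = R R†` and the trace formula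
applies to the kernel of `R`. -/
theorem hasPurity_kernelOp_comp_adjoint (hk : IsL2Kernel k) :
    HasPurity (kernelOp k hk ∘L ContinuousLinearMap.adjoint (kernelOp k hk))
      (∫ q, ‖selfAdjointKernel k q‖ ^ 2 ∂(volume.prod volume)) := by
  have h := isTrace_kernelOp_comp_adjoint hk.selfAdjointKernel
  rw [← kernelOp_comp_adjoint hk] at h
  have hsa := (ContinuousLinearMap.isPositive_self_comp_adjoint (kernelOp k hk)).isSelfAdjoint
  rwa [hsa.adjoint_eq] at h

/-- The operator `T_k T_k†` is the partial trace of the pure state with wave function `k`. -/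
theorem isPartialTraceB_kernelOp_comp_adjoint (hk : IsL2Kernel k) (ψ : L2 (α ⊕ β))
    (hψ : (ψ : (α ⊕ β → ℝ) → ℂ) =ᵐ[volume]
      fun x => k (fun a => x (Sum.inl a), fun b => x (Sum.inr b))) :
    IsPartialTraceB (InnerProductSpace.rankOne ℂ ψ ψ)
      (kernelOp k hk ∘L ContinuousLinearMap.adjoint (kernelOp k hk)) := by
  intro f g κ b
  -- Contracting `ψ` with `f` leaves the vector `conj (T† f)` of `L²(B)`; Parseval in `B` then sums
  -- the matrix elements of the partial trace.
  have key : ∀ (f : L2 α) (h : L2 β), ⟪ψ, tensor f h⟫_ℂ =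
      ⟪star (kernelOp (adjointKernel k) hk.adjoint f), h⟫_ℂ := by
    intro f h
    have hmp := volume_measurePreserving_sumPiEquivProdPi (fun _ : α ⊕ β => ℝ)
    have h1 : ⟪ψ, tensor f h⟫_ℂ = ∫ x : α ⊕ β → ℝ,
        (fun q : (α → ℝ) × (β → ℝ) => conj (k q) * (f q.1 * h q.2))
          (MeasurableEquiv.sumPiEquivProdPi (fun _ : α ⊕ β => ℝ) x) := by
      rw [L2.inner_def]
      refine integral_congr_ae ?_
      filter_upwards [hψ, (memLp_tensor f h).coeFn_toLp] with x hx hx'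
      change (tensor f h : (α ⊕ β → ℝ) → ℂ) x = _ at hx'
      rw [RCLike.inner_apply, hx, hx', mul_comm]
      rfl
    rw [h1]
    refine (hmp.integral_comp (MeasurableEquiv.measurableEmbedding _)
      (fun q : (α → ℝ) × (β → ℝ) => conj (k q) * (f q.1 * h q.2))).trans ?_
    refine (integral_conj_kernel_mul hk f h).trans ?_
    rw [L2.inner_def]
    refine integral_congr_ae ?_
    filter_upwards [Lp.coeFn_star (kernelOp (adjointKernel k) hk.adjoint f)] with y hy
    rw [hy, RCLike.inner_apply, Pi.star_apply, RCLike.star_def, Complex.conj_conj, mul_comm]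
  have hsum := b.hasSum_inner_mul_inner
    (star (kernelOp (adjointKernel k) hk.adjoint g))
    (star (kernelOp (adjointKernel k) hk.adjoint f))
  have e : ⟪star (kernelOp (adjointKernel k) hk.adjoint g),
      star (kernelOp (adjointKernel k) hk.adjoint f)⟫_ℂ =
      ⟪f, (kernelOp k hk ∘L ContinuousLinearMap.adjoint (kernelOp k hk)) g⟫_ℂ := by
    rw [ContinuousLinearMap.comp_apply, ← ContinuousLinearMap.adjoint_inner_left,
      adjoint_kernelOp, L2.inner_def, L2.inner_def]
    refine integral_congr_ae ?_
    filter_upwards [Lp.coeFn_star (kernelOp (adjointKernel k) hk.adjoint f),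
      Lp.coeFn_star (kernelOp (adjointKernel k) hk.adjoint g)] with y h1 h2
    rw [h1, h2, RCLike.inner_apply, RCLike.inner_apply, Pi.star_apply, Pi.star_apply,
      RCLike.star_def, Complex.conj_conj, mul_comm]
  rw [e] at hsum
  refine hsum.congr_fun fun j => ?_
  rw [InnerProductSpace.rankOne_apply, inner_smul_right, key, ← inner_conj_symm _ ψ, key,
    inner_conj_symm]

end KernelOperator

/-! ### Recovering a wave function from its Gaussian Wigner transform -/

section WeylCoordinates

variable {ι : Type} [Fintype ι]

/-- The change of variables `(x, y) ↦ (x + y/2, x - y/2)` preserves the volume. -/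
theorem measurePreserving_midpoint :
    MeasurePreserving (fun q : (ι → ℝ) × (ι → ℝ) =>
      (q.1 + (1 / 2 : ℝ) • q.2, q.1 - (1 / 2 : ℝ) • q.2))
      (volume.prod volume) (volume.prod volume) := by
  -- The map is a composition of swaps with two shears: `(x, y)` goes to `(x - y/2, y)`, then to `(x
  -- - y/2, x + y/2)`, and the coordinates are exchanged at the end.
  have h1 : MeasurePreserving (fun q : (ι → ℝ) × (ι → ℝ) => (q.1, q.2 - (1 / 2 : ℝ) • q.1))
      (volume.prod volume) (volume.prod volume) :=
    (MeasurePreserving.id volume).skew_product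
      (g := fun (y x : ι → ℝ) => x - (1 / 2 : ℝ) • y)
      (by unfold Function.uncurry; fun_prop)
      (Filter.Eventually.of_forall fun y =>
        (measurePreserving_sub_right volume ((1 / 2 : ℝ) • y)).map_eq)
  have h2 : MeasurePreserving (fun q : (ι → ℝ) × (ι → ℝ) => (q.1, q.2 + q.1))
      (volume.prod volume) (volume.prod volume) :=
    (MeasurePreserving.id volume).skew_product
      (g := fun (b y : ι → ℝ) => y + b)
      (by unfold Function.uncurry; fun_prop)
      (Filter.Eventually.of_forall fun b => (measurePreserving_add_right volume b).map_eq)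
  have h := Measure.measurePreserving_swap.comp (h2.comp (Measure.measurePreserving_swap.comp
    (h1.comp (Measure.measurePreserving_swap (μ := (volume : Measure (ι → ℝ)))
      (ν := (volume : Measure (ι → ℝ)))))))
  convert h using 1
  ext q i
  · simp
    ring
  · simp

theorem integrable_comp_affine {f : (ι → ℝ) → ℝ} (hf : Integrable f) (x : ι → ℝ) {c : ℝ}
    (hc : c ≠ 0) : Integrable (fun y => f (x + c • y)) :=
  (hf.comp_add_left x).comp_smul hc

theorem integral_comp_affine (f : (ι → ℝ) → ℝ) (x : ι → ℝ) (c : ℝ) :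
    ∫ y, f (x + c • y) = |(c ^ Fintype.card ι)⁻¹| * ∫ y, f y := by
  rw [Measure.integral_comp_smul volume (fun y => f (x + y)), Module.finrank_fintype_fun_eq_card,
    integral_add_left_eq_self, smul_eq_mul]

/-- Both factors are affine substitutions of an `L²` function, so this holds for every `x`, not just
almost every one. -/
theorem integrable_wigner_integrand (ψ : L2 ι) (x : ι → ℝ) :
    Integrable (fun y => ψ (x + (1 / 2 : ℝ) • y) * conj (ψ (x - (1 / 2 : ℝ) • y))) := by
  have hψ := (memLp_two_iff_integrable_sq_norm (Lp.aestronglyMeasurable ψ)).1 (Lp.memLp ψ)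
  have hm := (Lp.stronglyMeasurable ψ)
  have h : ∀ c : ℝ, c ≠ 0 → MemLp (fun y => ψ (x + c • y)) 2 volume := fun c hc =>
    (memLp_two_iff_integrable_sq_norm
      (hm.comp_measurable (by fun_prop)).aestronglyMeasurable).2
      (integrable_comp_affine hψ x hc)
  have h2 := (h (1 / 2) (by norm_num)).integrable_mul (h (-(1 / 2)) (by norm_num)).star
  refine h2.congr (Filter.Eventually.of_forall fun y => ?_)
  simp only [Pi.mul_apply, Pi.star_apply, neg_smul, ← sub_eq_add_neg]
  rfl

variable [DecidableEq ι]

/-- The inverse semiclassical Fourier transform of a phase space Gaussian in its momenta. -/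
noncomputable def gaussianKernel (ħ : ℝ) (P : Matrix (ι ⊕ ι) (ι ⊕ ι) ℝ) (c : Phase ι)
    (x y : ι → ℝ) : ℂ :=
  ∫ p, Complex.exp (Complex.I * ((p ⬝ᵥ y : ℝ) : ℂ) / (ħ : ℂ)) *
    (phaseGaussian ħ P c (Sum.elim x p) : ℂ)

variable {P : Matrix (ι ⊕ ι) (ι ⊕ ι) ℝ}

theorem norm_exp_I_mul_div (ħ r : ℝ) : ‖Complex.exp (Complex.I * (r : ℂ) / (ħ : ℂ))‖ = 1 := by
  rw [mul_div_assoc, ← Complex.ofReal_div, mul_comm]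
  exact Complex.norm_exp_ofReal_mul_I _

omit [DecidableEq ι] in
theorem integrable_exp_neg_sub {b : ℝ} (hb : 0 < b) (a : ι → ℝ) :
    Integrable (fun p : ι → ℝ => Real.exp (-b * ((p - a) ⬝ᵥ (p - a)))) :=
  (integrable_exp_neg_dotProduct_self hb).comp_sub_right a

omit [DecidableEq ι] in
theorem exp_neg_dotProduct_self_le_one {b : ℝ} (hb : 0 < b) (x : ι → ℝ) :
    Real.exp (-b * (x ⬝ᵥ x)) ≤ 1 := by
  rw [Real.exp_le_one_iff]
  have : 0 ≤ x ⬝ᵥ x := Finset.sum_nonneg fun i _ => mul_self_nonneg _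
  nlinarith

theorem continuous_sumElim {α β : Type} :
    Continuous (fun q : (α → ℝ) × (β → ℝ) => (Sum.elim q.1 q.2 : α ⊕ β → ℝ)) := by
  refine continuous_pi fun i => ?_
  rcases i with i | i <;> simp only [Sum.elim_inl, Sum.elim_inr] <;> fun_prop

/-- A bound uniform in `x`, dominating the momentum integral when its continuity in the parameters
is proved. -/
theorem exists_phaseGaussian_le_mom {ħ : ℝ} (hħ : 0 < ħ) (hP : P.PosDef) (c : Phase ι) :
    ∃ C b : ℝ, 0 < b ∧ ∀ x p : ι → ℝ, phaseGaussian ħ P c (Sum.elim x p) ≤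
      C * Real.exp (-b * ((p - mom c) ⬝ᵥ (p - mom c))) := by
  obtain ⟨C, b, hb, hC, h⟩ := exists_phaseGaussian_le hħ hP c
  refine ⟨C, b, hb, fun x p => (h _).trans (mul_le_mul_of_nonneg_left ?_ hC)⟩
  exact mul_le_of_le_one_left (Real.exp_nonneg _) (exp_neg_dotProduct_self_le_one hb _)

theorem continuous_exp_mul_phaseGaussian (ħ : ℝ) (P : Matrix (ι ⊕ ι) (ι ⊕ ι) ℝ) (c : Phase ι) :
    Continuous (fun r : ((ι → ℝ) × (ι → ℝ)) × (ι → ℝ) =>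
      Complex.exp (Complex.I * ((r.2 ⬝ᵥ r.1.2 : ℝ) : ℂ) / (ħ : ℂ)) *
        (phaseGaussian ħ P c (Sum.elim r.1.1 r.2) : ℂ)) := by
  have h1 : Continuous (fun r : ((ι → ℝ) × (ι → ℝ)) × (ι → ℝ) =>
      phaseGaussian ħ P c (Sum.elim r.1.1 r.2)) :=
    (continuous_phaseGaussian ħ P c).comp (continuous_sumElim.comp
      ((continuous_fst.comp continuous_fst).prodMk continuous_snd))
  refine Continuous.mul ?_ (Complex.continuous_ofReal.comp h1)
  unfold dotProduct
  fun_prop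

omit [DecidableEq ι] in
theorem continuous_integral_of_le {X : Type*} [TopologicalSpace X] [FirstCountableTopology X]
    {F : X × (ι → ℝ) → ℂ} (hF : Continuous F) {g : (ι → ℝ) → ℝ} (hg : Integrable g)
    (h : ∀ x p, ‖F (x, p)‖ ≤ g p) : Continuous (fun x => ∫ p, F (x, p)) :=
  continuous_of_dominated
    (fun x => (hF.comp (Continuous.prodMk_right x)).aestronglyMeasurable)
    (fun x => Filter.Eventually.of_forall (h x)) hg
    (Filter.Eventually.of_forall fun p => hF.comp (Continuous.prodMk_left p))

theorem continuous_gaussianKernel {ħ : ℝ} (hħ : 0 < ħ) (hP : P.PosDef) (c : Phase ι) :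
    Continuous (fun q : (ι → ℝ) × (ι → ℝ) => gaussianKernel ħ P c q.1 q.2) := by
  obtain ⟨C, b, hb, h⟩ := exists_phaseGaussian_le_mom hħ hP c
  refine continuous_integral_of_le (continuous_exp_mul_phaseGaussian ħ P c)
    ((integrable_exp_neg_sub hb (mom c)).const_mul C) fun q p => ?_
  rw [norm_mul, norm_exp_I_mul_div, one_mul, Complex.norm_real,
    Real.norm_of_nonneg (phaseGaussian_nonneg hħ P c _)]
  exact h _ _

theorem integrable_phaseGaussian_mom {ħ : ℝ} (hħ : 0 < ħ) (hP : P.PosDef) (c : Phase ι)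
    (x : ι → ℝ) : Integrable (fun p => phaseGaussian ħ P c (Sum.elim x p)) := by
  obtain ⟨C, b, hb, h⟩ := exists_phaseGaussian_le_mom hħ hP c
  refine ((integrable_exp_neg_sub hb (mom c)).const_mul C).mono'
    ((continuous_phaseGaussian ħ P c).comp (continuous_sumElim.comp
        (Continuous.prodMk_right x))).aestronglyMeasurable
    (Filter.Eventually.of_forall fun p => ?_)
  rw [Real.norm_of_nonneg (phaseGaussian_nonneg hħ P c _)]
  exact h _ _

/-- Recovery of the density matrix of a pure state from its Gaussian Wigner transform. -/
theorem ae_mul_conj_eq_gaussianKernel {ħ : ℝ} (hħ : 0 < ħ) (hP : P.PosDef) (c : Phase ι)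
    (ψ : L2 ι) (hψ : ∀ z, wigner ħ ψ z = (phaseGaussian ħ P c z : ℂ)) :
    ∀ᵐ q : (ι → ℝ) × (ι → ℝ) ∂(volume.prod volume),
      ψ q.1 * conj (ψ q.2) = gaussianKernel ħ P c ((1 / 2 : ℝ) • (q.1 + q.2)) (q.1 - q.2) := by
  have hm : MeasurableSet {q : (ι → ℝ) × (ι → ℝ) | ψ q.1 * conj (ψ q.2) =
      gaussianKernel ħ P c ((1 / 2 : ℝ) • (q.1 + q.2)) (q.1 - q.2)} := by
    have h1 := (Lp.stronglyMeasurable ψ).measurable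
    have h2 := ((continuous_gaussianKernel hħ hP c).comp
      (by fun_prop : Continuous fun q : (ι → ℝ) × (ι → ℝ) =>
        ((1 / 2 : ℝ) • (q.1 + q.2), q.1 - q.2))).measurable
    have h3 : Measurable (fun q : (ι → ℝ) × (ι → ℝ) => ψ q.1 * conj (ψ q.2)) :=
      (h1.comp measurable_fst).mul (Complex.continuous_conj.measurable.comp
        (h1.comp measurable_snd))
    exact measurableSet_eq_fun h3 h2
  have hS := measurePreserving_midpoint (ι := ι)
  -- In midpoint and difference coordinates the claim is, for each fixed `x`, Fourier inversion in
  -- `p` for almost every `y`.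
  rw [← hS.map_eq, ae_map_iff hS.aemeasurable hm]
  refine (Measure.ae_prod_iff_ae_ae (hS.measurable hm)).2
    (Filter.Eventually.of_forall fun x => ?_)
  have h := ae_eq_integral_of_transform hħ (integrable_wigner_integrand ψ x)
    (integrable_phaseGaussian_mom hħ hP c x).ofReal (fun p => hψ (Sum.elim x p))
  filter_upwards [h] with y hy
  have e1 : (1 / 2 : ℝ) • (x + (1 / 2 : ℝ) • y + (x - (1 / 2 : ℝ) • y)) = x := by
    ext i
    simp
    ring
  have e2 : x + (1 / 2 : ℝ) • y - (x - (1 / 2 : ℝ) • y) = y := by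
    ext i
    simp
    ring
  change _ = gaussianKernel ħ P c ((1 / 2 : ℝ) • (x + (1 / 2 : ℝ) • y + (x - (1 / 2 : ℝ) • y)))
    (x + (1 / 2 : ℝ) • y - (x - (1 / 2 : ℝ) • y))
  rw [e1, e2]
  exact hy

/-- A state with Gaussian Wigner transform has a continuous wave function. -/
theorem exists_continuous_of_wigner_eq {ħ : ℝ} (hħ : 0 < ħ) (hP : P.PosDef) (c : Phase ι)
    (ψ : L2 ι) (hψ0 : ψ ≠ 0) (hψ : ∀ z, wigner ħ ψ z = (phaseGaussian ħ P c z : ℂ)) :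
    ∃ φ : (ι → ℝ) → ℂ, Continuous φ ∧ (ψ : (ι → ℝ) → ℂ) =ᵐ[volume] φ ∧
      ∀ a b, φ a * conj (φ b) = gaussianKernel ħ P c ((1 / 2 : ℝ) • (a + b)) (a - b) := by
  have h := ae_mul_conj_eq_gaussianKernel hħ hP c ψ hψ
  have h' := Measure.measurePreserving_swap.quasiMeasurePreserving.ae h
  have h2 := Measure.ae_ae_of_ae_prod h'
  -- As `ψ ≠ 0`, some `b` has `ψ b ≠ 0` and satisfies the identity for almost all `a`; dividing by
  -- `conj (ψ b)` exhibits `ψ` as a continuous function.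
  have h3 : ∃ b, ψ b ≠ 0 ∧ ∀ᵐ a, ψ a * conj (ψ b) =
      gaussianKernel ħ P c ((1 / 2 : ℝ) • (a + b)) (a - b) := by
    by_contra hcon
    refine hψ0 (Lp.eq_zero_iff_ae_eq_zero.2 ?_)
    filter_upwards [h2] with b hb
    by_contra hb0
    exact hcon ⟨b, hb0, hb⟩
  obtain ⟨b, hb, hab⟩ := h3
  have hb' : conj (ψ b) ≠ 0 := (map_ne_zero _).2 hb
  have hG := continuous_gaussianKernel hħ hP c
  have hφ : Continuous (fun a : ι → ℝ =>
      gaussianKernel ħ P c ((1 / 2 : ℝ) • (a + b)) (a - b) / conj (ψ b)) :=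
    (hG.comp (by fun_prop : Continuous fun a : ι → ℝ =>
      ((1 / 2 : ℝ) • (a + b), a - b))).div_const _
  have hae : (ψ : (ι → ℝ) → ℂ) =ᵐ[volume] fun a =>
      gaussianKernel ħ P c ((1 / 2 : ℝ) • (a + b)) (a - b) / conj (ψ b) := by
    filter_upwards [hab] with a ha
    rw [eq_div_iff hb', ha]
  refine ⟨_, hφ, hae, ?_⟩
  set φ := fun a : ι → ℝ => gaussianKernel ħ P c ((1 / 2 : ℝ) • (a + b)) (a - b) / conj (ψ b)
  have h4 : (fun q : (ι → ℝ) × (ι → ℝ) => φ q.1 * conj (φ q.2)) =ᵐ[volume.prod volume]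
      fun q => gaussianKernel ħ P c ((1 / 2 : ℝ) • (q.1 + q.2)) (q.1 - q.2) := by
    filter_upwards [h, Measure.quasiMeasurePreserving_fst.ae hae,
      Measure.quasiMeasurePreserving_snd.ae hae] with q h1 h2 h3
    rw [← h1, h2, h3]
  -- Both sides are continuous, so almost everywhere equality holds everywhere; in particular it may
  -- be restricted to the diagonal in `B`.
  have h5 := Continuous.ae_eq_iff_eq (volume.prod volume)
    (by fun_prop : Continuous fun q : (ι → ℝ) × (ι → ℝ) => φ q.1 * conj (φ q.2))
    (hG.comp (by fun_prop : Continuous fun q : (ι → ℝ) × (ι → ℝ) =>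
      ((1 / 2 : ℝ) • (q.1 + q.2), q.1 - q.2))) |>.1 h4
  exact fun a b => congrFun h5 (a, b)

end WeylCoordinates

/-! ### Integrating out the `B` positions -/

section ReducedState

variable {α β : Type} [Fintype α] [Fintype β]

omit [Fintype α] [Fintype β] in
theorem sumElim_eq_sumPiEquivProdPi_symm :
    (fun q : (α → ℝ) × (β → ℝ) => (Sum.elim q.1 q.2 : α ⊕ β → ℝ)) =
      (MeasurableEquiv.sumPiEquivProdPi (fun _ : α ⊕ β => ℝ)).symm := by
  funext q i
  rcases i with i | i <;> rfl

theorem measurePreserving_sumElim :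
    MeasurePreserving (fun q : (α → ℝ) × (β → ℝ) => (Sum.elim q.1 q.2 : α ⊕ β → ℝ))
      (volume.prod volume) volume := by
  rw [sumElim_eq_sumPiEquivProdPi_symm]
  exact (volume_measurePreserving_sumPiEquivProdPi (fun _ : α ⊕ β => ℝ)).symm

omit [Fintype α] [Fintype β] in
theorem measurableEmbedding_sumElim :
    MeasurableEmbedding (fun q : (α → ℝ) × (β → ℝ) => (Sum.elim q.1 q.2 : α ⊕ β → ℝ)) := by
  rw [sumElim_eq_sumPiEquivProdPi_symm]
  exact MeasurableEquiv.measurableEmbedding _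

theorem integral_sumElim {E : Type*} [NormedAddCommGroup E] [NormedSpace ℝ E]
    (f : (α ⊕ β → ℝ) → E) :
    ∫ x, f x = ∫ q : (α → ℝ) × (β → ℝ), f (Sum.elim q.1 q.2) ∂(volume.prod volume) :=
  (measurePreserving_sumElim.integral_comp measurableEmbedding_sumElim f).symm

theorem integrable_sumElim {E : Type*} [NormedAddCommGroup E] {f : (α ⊕ β → ℝ) → E} :
    Integrable (fun q : (α → ℝ) × (β → ℝ) => f (Sum.elim q.1 q.2)) (volume.prod volume) ↔
      Integrable f :=
  measurePreserving_sumElim.integrable_comp_emb measurableEmbedding_sumElim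

theorem IsL2Kernel.memLp_comp_affine {k : (α → ℝ) × (β → ℝ) → ℂ} (hk : IsL2Kernel k)
    (hkc : Continuous k) (x : α → ℝ) {c : ℝ} (hc : c ≠ 0) :
    IsL2Kernel (fun q => k (x + c • q.1, q.2)) := by
  have hcont : Continuous (fun q : (α → ℝ) × (β → ℝ) => k (x + c • q.1, q.2)) := by fun_prop
  refine (memLp_two_iff_integrable_sq_norm hcont.aestronglyMeasurable).2 ?_
  have h := (memLp_two_iff_integrable_sq_norm hk.1).1 hk
  refine (integrable_prod_iff' (by fun_prop : Continuous fun q : (α → ℝ) × (β → ℝ) =>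
    ‖k (x + c • q.1, q.2)‖ ^ 2).aestronglyMeasurable).2 ⟨?_, ?_⟩
  · filter_upwards [h.prod_left_ae] with y hy
    exact integrable_comp_affine hy x hc
  · have e : ∀ y : β → ℝ, ∫ a, ‖‖k (x + c • a, y)‖ ^ 2‖ =
        |(c ^ Fintype.card α)⁻¹| * ∫ a, ‖k (a, y)‖ ^ 2 := fun y => by
      simp only [norm_pow, norm_norm]
      exact integral_comp_affine (fun a => ‖k (a, y)‖ ^ 2) x c
    simp only [e]
    exact h.integral_prod_right.const_mul _

/-- The reduced density matrix is integrable along the directions `(y/2, -y/2)`. -/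
theorem IsL2Kernel.integrable_selfAdjointKernel {k : (α → ℝ) × (β → ℝ) → ℂ} (hk : IsL2Kernel k)
    (hkc : Continuous k) (x : α → ℝ) :
    Integrable (fun y => ThawedGaussian.selfAdjointKernel k
      (x + (1 / 2 : ℝ) • y, x - (1 / 2 : ℝ) • y)) := by
  have h := (MemLp.integrable_mul (p := 2) (q := 2)
    (hk.memLp_comp_affine hkc x (c := 1 / 2) (by norm_num))
    (hk.memLp_comp_affine hkc x (c := -(1 / 2)) (by norm_num)).star).integral_prod_left
  refine h.congr (Filter.Eventually.of_forall fun y => ?_)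
  simp only [ThawedGaussian.selfAdjointKernel, Pi.mul_apply, Pi.star_apply, neg_smul,
    ← sub_eq_add_neg]
  rfl

variable [DecidableEq α] [DecidableEq β]
  {P : Matrix ((α ⊕ β) ⊕ (α ⊕ β)) ((α ⊕ β) ⊕ (α ⊕ β)) ℝ}

omit [Fintype α] [Fintype β] [DecidableEq α] [DecidableEq β] in
theorem sumElim_sumElim_eq_joinAB (x : α → ℝ) (y : β → ℝ) (p : α → ℝ) (r : β → ℝ) :
    (Sum.elim (Sum.elim x y) (Sum.elim p r) : Phase (α ⊕ β)) =
      joinAB (Sum.elim x p) (Sum.elim y r) := by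
  ext i
  rcases i with (i | i) | (i | i) <;> rfl

omit [DecidableEq α] [DecidableEq β] in
theorem dotProduct_sumElim_self (a : α ⊕ β → ℝ) (x : α → ℝ) (y : β → ℝ) :
    (Sum.elim x y - a) ⬝ᵥ (Sum.elim x y - a) =
      (x - a ∘ Sum.inl) ⬝ᵥ (x - a ∘ Sum.inl) + (y - a ∘ Sum.inr) ⬝ᵥ (y - a ∘ Sum.inr) := by
  simp [dotProduct]

/-- With `x_A` fixed, the factorized bound still decays in `x_B`, `p_A` and `p_B`; this licenses the
exchanges of integrals in the reduction. -/
theorem integrable_phaseGaussian_partial {ħ : ℝ} (hħ : 0 < ħ) (hP : P.PosDef)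
    (c : Phase (α ⊕ β)) (x : α → ℝ) :
    Integrable (fun r : (β → ℝ) × ((α → ℝ) × (β → ℝ)) =>
      phaseGaussian ħ P c (Sum.elim (Sum.elim x r.1) (Sum.elim r.2.1 r.2.2)))
      (volume.prod (volume.prod volume)) := by
  obtain ⟨C, b, hb, hC, h⟩ := exists_phaseGaussian_le hħ hP c
  have hcont : Continuous (fun r : (β → ℝ) × ((α → ℝ) × (β → ℝ)) =>
      phaseGaussian ħ P c (Sum.elim (Sum.elim x r.1) (Sum.elim r.2.1 r.2.2))) :=
    (continuous_phaseGaussian ħ P c).comp (continuous_sumElim.comp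
      ((continuous_sumElim.comp (by fun_prop : Continuous fun r : (β → ℝ) × ((α → ℝ) × (β → ℝ)) =>
        (x, r.1))).prodMk (continuous_sumElim.comp (by fun_prop :
          Continuous fun r : (β → ℝ) × ((α → ℝ) × (β → ℝ)) => (r.2.1, r.2.2)))))
  refine ((((integrable_exp_neg_sub hb (pos c ∘ Sum.inr)).mul_prod
    ((integrable_exp_neg_sub hb (mom c ∘ Sum.inl)).mul_prod
      (integrable_exp_neg_sub hb (mom c ∘ Sum.inr)))).const_mul C).mono'
    hcont.aestronglyMeasurable (Filter.Eventually.of_forall fun r => ?_))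
  rw [Real.norm_of_nonneg (phaseGaussian_nonneg hħ P c _)]
  refine (h _).trans (mul_le_mul_of_nonneg_left ?_ hC)
  have e1 : pos (Sum.elim (Sum.elim x r.1) (Sum.elim r.2.1 r.2.2) : Phase (α ⊕ β)) =
      Sum.elim x r.1 := rfl
  have e2 : mom (Sum.elim (Sum.elim x r.1) (Sum.elim r.2.1 r.2.2) : Phase (α ⊕ β)) =
      Sum.elim r.2.1 r.2.2 := rfl
  rw [e1, e2, dotProduct_sumElim_self, dotProduct_sumElim_self, mul_add, mul_add, Real.exp_add,
    Real.exp_add]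
  exact mul_le_mul_of_nonneg_right
    (mul_le_of_le_one_left (Real.exp_nonneg _) (exp_neg_dotProduct_self_le_one hb _))
    (by positivity)

/-- Integrating out the `B` variables on the diagonal reduces Gaussian kernels to Gaussian
kernels. -/
theorem integral_gaussianKernel {ħ : ℝ} (hħ : 0 < ħ) (hP : P.PosDef) (c : Phase (α ⊕ β))
    (x y : α → ℝ) :
    ∫ b : β → ℝ, gaussianKernel ħ P c (Sum.elim x b) (Sum.elim y 0) =
      gaussianKernel ħ (schurA P) (projA c) x y := by
  have hi := integrable_phaseGaussian_partial hħ hP c x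
  have hi' : Integrable (fun r : (β → ℝ) × ((α → ℝ) × (β → ℝ)) =>
      Complex.exp (Complex.I * ((r.2.1 ⬝ᵥ y : ℝ) : ℂ) / (ħ : ℂ)) *
      (phaseGaussian ħ P c (Sum.elim (Sum.elim x r.1) (Sum.elim r.2.1 r.2.2)) : ℂ))
      (volume.prod (volume.prod volume)) := by
    refine hi.ofReal.bdd_mul (c := 1) (Continuous.aestronglyMeasurable ?_)
      (Filter.Eventually.of_forall fun r => (norm_exp_I_mul_div ħ _).le)
    unfold dotProduct
    fun_prop
  -- On the diagonal in `B` the difference variable is `(y, 0)`, so `p_B` drops out of the phase and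
  -- only the Gaussian marginal remains.
  have hy : ∀ (p : α → ℝ) (r : β → ℝ), Sum.elim p r ⬝ᵥ (Sum.elim y 0 : α ⊕ β → ℝ) = p ⬝ᵥ y := by
    intro p r
    simp [dotProduct]
  calc ∫ b : β → ℝ, gaussianKernel ħ P c (Sum.elim x b) (Sum.elim y 0)
      = ∫ b : β → ℝ, ∫ q : (α → ℝ) × (β → ℝ),
          Complex.exp (Complex.I * ((q.1 ⬝ᵥ y : ℝ) : ℂ) / (ħ : ℂ)) *
            (phaseGaussian ħ P c (Sum.elim (Sum.elim x b) (Sum.elim q.1 q.2)) : ℂ)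
          ∂(volume.prod volume) := by
        congr 1 with b
        rw [gaussianKernel, integral_sumElim]
        simp only [hy]
    _ = ∫ q : (α → ℝ) × (β → ℝ), (∫ b : β → ℝ,
          Complex.exp (Complex.I * ((q.1 ⬝ᵥ y : ℝ) : ℂ) / (ħ : ℂ)) *
            (phaseGaussian ħ P c (Sum.elim (Sum.elim x b) (Sum.elim q.1 q.2)) : ℂ))
          ∂(volume.prod volume) := integral_integral_swap hi'
    _ = ∫ p : α → ℝ, ∫ r : β → ℝ, ∫ b : β → ℝ,
          Complex.exp (Complex.I * ((p ⬝ᵥ y : ℝ) : ℂ) / (ħ : ℂ)) *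
            (phaseGaussian ħ P c (Sum.elim (Sum.elim x b) (Sum.elim p r)) : ℂ) :=
        integral_prod _ hi'.integral_prod_right
    _ = gaussianKernel ħ (schurA P) (projA c) x y := by
        rw [gaussianKernel]
        congr 1 with p
        rw [← integral_phaseGaussian_joinAB hħ hP c, ← integral_complex_ofReal,
          ← integral_const_mul, integral_sumElim, integral_prod_symm]
        · simp only [sumElim_sumElim_eq_joinAB]
        · exact (integrable_sumElim (f := fun v : Phase β =>
            Complex.exp (Complex.I * ((p ⬝ᵥ y : ℝ) : ℂ) / (ħ : ℂ)) *
              (phaseGaussian ħ P c (joinAB (Sum.elim x p) v) : ℂ))).2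
            (((integrable_phaseGaussian_joinAB hħ hP c (Sum.elim x p)).ofReal).const_mul _)

end ReducedState

/-! ### The reduced state, its Wigner distribution and its purity -/

section Main

variable {α β : Type} [Fintype α] [Fintype β] [DecidableEq α] [DecidableEq β]
  {P : Matrix ((α ⊕ β) ⊕ (α ⊕ β)) ((α ⊕ β) ⊕ (α ⊕ β)) ℝ}

/-- The points `(x + y/2, b)` and `(x - y/2, b)` have midpoint `(x, b)` and difference `(y, 0)`. -/
theorem selfAdjointKernel_eq_gaussianKernel {ħ : ℝ} (hħ : 0 < ħ) (hP : P.PosDef)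
    (c : Phase (α ⊕ β)) {φ : (α ⊕ β → ℝ) → ℂ}
    (hφ : ∀ a b, φ a * conj (φ b) = gaussianKernel ħ P c ((1 / 2 : ℝ) • (a + b)) (a - b))
    (x y : α → ℝ) :
    selfAdjointKernel (fun q : (α → ℝ) × (β → ℝ) => φ (Sum.elim q.1 q.2))
      (x + (1 / 2 : ℝ) • y, x - (1 / 2 : ℝ) • y) =
      gaussianKernel ħ (schurA P) (projA c) x y := by
  rw [← integral_gaussianKernel hħ hP, selfAdjointKernel]
  congr 1 with b
  rw [hφ]
  congr 1
  · ext i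
    rcases i with i | i
    · simp
      ring
    · simp
      ring
  · ext i
    rcases i with i | i
    · simp
      ring
    · simp

theorem integral_sq_phaseGaussian_eq_integral_integral {ι : Type} [Fintype ι] [DecidableEq ι]
    {ħ : ℝ} (hħ : 0 < ħ) {M : Matrix (ι ⊕ ι) (ι ⊕ ι) ℝ} (hM : M.PosDef) (c : Phase ι) :
    ∫ x, ∫ p, phaseGaussian ħ M c (Sum.elim x p) ^ 2 =
      ((2 * Real.pi * ħ) ^ Fintype.card ι)⁻¹ * √M.det := by
  rw [← integral_sq_phaseGaussian hħ hM c, integral_sumElim, integral_prod]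
  exact (integrable_sumElim (f := fun z => phaseGaussian ħ M c z ^ 2)).2
    (integrable_sq_phaseGaussian hħ hM c)

/-- The reduced state of a pure state with Gaussian Wigner transform. -/
theorem exists_reducedState {ħ : ℝ} (hħ : 0 < ħ) (hP : P.PosDef) (hdet : P.det = 1)
    (c : Phase (α ⊕ β)) (ψ : L2 (α ⊕ β)) (hψ1 : ‖ψ‖ = 1)
    (hψ : ∀ z, wigner ħ ψ z = (phaseGaussian ħ P c z : ℂ)) :
    ∃ ρA : L2 α →L[ℂ] L2 α,
      IsPartialTraceB (InnerProductSpace.rankOne ℂ ψ ψ) ρA ∧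
      IsDensityOperator ρA ∧
      IsWignerDistribution ħ ρA (phaseGaussian ħ (schurA P) (projA c)) ∧
      HasPurity ρA (1 / √(blockBB P).det) := by
  obtain ⟨φ, hφc, hφ, hφG⟩ := exists_continuous_of_wigner_eq hħ hP c ψ
    (by rintro rfl; simp at hψ1) hψ
  have hM := posDef_schurA hP
  set k : (α → ℝ) × (β → ℝ) → ℂ := fun q => φ (Sum.elim q.1 q.2) with hk
  have hkc : Continuous k := hφc.comp continuous_sumElim
  have hφL : MemLp φ 2 volume := (memLp_congr_ae hφ).1 (Lp.memLp ψ)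
  have hkL : IsL2Kernel k := hφL.comp_measurePreserving measurePreserving_sumElim
  have hk1 : ∫ q, ‖k q‖ ^ 2 ∂(volume.prod volume) = 1 := by
    have h := L2.norm_sq_eq_integral ψ
    rw [hψ1, one_pow] at h
    rw [h, ← integral_sumElim (fun x => ‖φ x‖ ^ 2)]
    refine integral_congr_ae ?_
    filter_upwards [hφ] with x hx
    rw [hx]
  have hK : ∀ x y : α → ℝ, selfAdjointKernel k
      (x + (1 / 2 : ℝ) • y, x - (1 / 2 : ℝ) • y) =
      gaussianKernel ħ (schurA P) (projA c) x y :=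
    selfAdjointKernel_eq_gaussianKernel hħ hP c hφG
  -- Integrability in `y` is inherited from the reduced density matrix, so no explicit formula for
  -- the Gaussian kernel is needed.
  have hKi : ∀ x, Integrable (gaussianKernel ħ (schurA P) (projA c) x) := fun x =>
    (hkL.integrable_selfAdjointKernel hkc x).congr
      (Filter.Eventually.of_forall fun y => hK x y)
  have hwi : ∀ x, Integrable (fun p : α → ℝ =>
      (phaseGaussian ħ (schurA P) (projA c) (Sum.elim x p) : ℂ)) := fun x =>
    (integrable_phaseGaussian_mom hħ hM (projA c) x).ofReal
  have hwc : ∀ x, Continuous (fun p : α → ℝ =>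
      (phaseGaussian ħ (schurA P) (projA c) (Sum.elim x p) : ℂ)) := fun x =>
    Complex.continuous_ofReal.comp ((continuous_phaseGaussian _ _ _).comp
      (continuous_sumElim.comp (Continuous.prodMk_right x)))
  refine ⟨_, isPartialTraceB_kernelOp_comp_adjoint hkL ψ ?_,
    isDensityOperator_kernelOp_comp_adjoint hkL hk1,
    ⟨_, hasKernel_kernelOp_comp_adjoint hkL, Filter.Eventually.of_forall fun z => ?_⟩, ?_⟩
  · filter_upwards [hφ] with x hx
    rw [hx, hk]
    congr 1
    ext i
    rcases i with i | i <;> rfl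
  -- `gaussianKernel` is by definition an inverse transform, so inversion gives the Wigner transform
  -- at every `z`.
  · have h := transform_integral_eq hħ (hKi (pos z)) (hwi (pos z)) (hwc (pos z))
      (fun y => rfl) (mom z)
    have hz : Sum.elim (pos z) (mom z) = z := by
      ext i
      rcases i with i | i <;> rfl
    rw [hz] at h
    rw [← h, wignerKernel]
    simp only [hK]
  · have h := hasPurity_kernelOp_comp_adjoint hkL
    have hS := measurePreserving_midpoint (ι := α)
    have hm := (memLp_two_iff_integrable_sq_norm hkL.selfAdjointKernel.1).1 hkL.selfAdjointKernel
    -- Pass to midpoint and difference, use Plancherel in `y` for each `x`, then integrate the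
    -- squared Gaussian over phase space; the powers of `2πħ` cancel.
    have e1 : ∫ q, ‖selfAdjointKernel k q‖ ^ 2 ∂(volume.prod volume) =
        √(schurA P).det := by
      have hm' : Integrable (fun q => ‖selfAdjointKernel k q‖ ^ 2)
          (Measure.map (fun q : (α → ℝ) × (α → ℝ) =>
            (q.1 + (1 / 2 : ℝ) • q.2, q.1 - (1 / 2 : ℝ) • q.2)) (volume.prod volume)) := by
        rwa [hS.map_eq]
      have hm2 := hm'.comp_aemeasurable hS.aemeasurable
      have e2 : ∀ x, ∫ y, ‖gaussianKernel ħ (schurA P) (projA c) x y‖ ^ 2 =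
          (2 * Real.pi * ħ) ^ Fintype.card α *
            ∫ p, phaseGaussian ħ (schurA P) (projA c) (Sum.elim x p) ^ 2 := by
        intro x
        have := integral_norm_sq_eq_of_transform hħ (hKi x) (hwi x) (hwc x) (fun y => rfl)
        simpa only [Complex.norm_real, Real.norm_eq_abs, sq_abs] using this
      conv_lhs => rw [← hS.map_eq]
      rw [integral_map hS.aemeasurable hm'.1]
      refine (integral_prod _ hm2).trans ?_
      simp only [Function.comp, hK, e2]
      rw [integral_const_mul, integral_sq_phaseGaussian_eq_integral_integral hħ hM,
        mul_inv_cancel_left₀ (by positivity)]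
    have e3 : 1 / √(blockBB P).det = √(schurA P).det := by
      have h1 := det_eq_det_blockBB_mul_det_schurA hP
      rw [hdet] at h1
      rw [div_eq_iff (Real.sqrt_pos.2 (posDef_blockBB hP).det_pos).ne',
        ← Real.sqrt_mul hM.det_pos.le, mul_comm, ← h1, Real.sqrt_one]
    rwa [e3, ← e1]

end Main

end ThawedGaussian

theorem mainTheorem1 (nA nB : ℕ) (ħ : ℝ) (hħ : 0 < ħ)
    -- the Hamiltonian, twice continuously differentiable in `z` and once in `t`
    (H : ℝ → Phase (Fin nA ⊕ Fin nB) → ℝ)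
    (hHz : ∀ t, ContDiff ℝ 2 (H t)) (hHt : ∀ z, ContDiff ℝ 1 (fun t => H t z))
    -- its flow, the reference orbit `z_t = Φ t z₀` and the Jacobian `S_t(z₀)`
    (I : Set ℝ) (hI : I.OrdConnected) (hI0 : (0 : ℝ) ∈ I)
    (z₀ : Phase (Fin nA ⊕ Fin nB)) (U : Set (Phase (Fin nA ⊕ Fin nB))) (hU : U ∈ nhds z₀)
    (Φ : ℝ → Phase (Fin nA ⊕ Fin nB) → Phase (Fin nA ⊕ Fin nB))
    (hΦ : IsHamiltonianFlowOn H I U Φ)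
    -- the metaplectic lift of `t ↦ S_t(z₀)` and the phase correction
    (Shat : ℝ → (L2 (Fin nA ⊕ Fin nB) ≃ₗᵢ[ℂ] L2 (Fin nA ⊕ Fin nB)))
    (hShat : IsMetaplecticLift ħ I (flowJacobian Φ z₀) Shat)
    (γ : ℝ → ℝ) (t : ℝ) (ht : t ∈ I)
    -- the state of the whole system at time `t`
    (ψ : L2 (Fin nA ⊕ Fin nB))
    (hψ : ψ = semiclassicalPropagator ħ (γ t) (Φ t z₀) z₀ (Shat t) (coherentState hħ z₀))
    (P : Matrix ((Fin nA ⊕ Fin nB) ⊕ (Fin nA ⊕ Fin nB)) ((Fin nA ⊕ Fin nB) ⊕ (Fin nA ⊕ Fin nB)) ℝ)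
    (hP : P = (flowJacobian Φ z₀ t * (flowJacobian Φ z₀ t)ᵀ)⁻¹)
    (M : Matrix (Fin nA ⊕ Fin nA) (Fin nA ⊕ Fin nA) ℝ)
    (hM : M = schurA P) :
    (blockBB P).PosDef ∧ M.PosDef ∧
    -- the marginal of the Wigner transform of the whole state
    (∀ zA : Phase (Fin nA),
      Integrable (fun zB : Phase (Fin nB) => wigner ħ ψ (joinAB zA zB)) volume ∧
      ∫ zB : Phase (Fin nB), wigner ħ ψ (joinAB zA zB)
        = (phaseGaussian ħ M (projA (Φ t z₀)) zA : ℂ)) ∧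
    -- the reduced density operator, its Wigner distribution and its purity
    ∃ ρA : L2 (Fin nA) →L[ℂ] L2 (Fin nA),
      IsPartialTraceB (InnerProductSpace.rankOne ℂ ψ ψ) ρA ∧
      IsDensityOperator ρA ∧
      IsWignerDistribution ħ ρA (phaseGaussian ħ M (projA (Φ t z₀))) ∧
      HasPurity ρA (1 / Real.sqrt (blockBB P).det) := by
  have hV := hShat.lift t ht
  set S := flowJacobian Φ z₀ t
  -- `det S = ±1` is read off the metaplectic generators; it suffices for the invertibility of `S`
  -- and for `det P = 1`.
  have hdet : S.det ^ 2 = 1 := hV.intertwines.2.2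
  have hS : IsUnit S := (Matrix.isUnit_iff_isUnit_det S).2
    (isUnit_iff_ne_zero.2 fun h0 => by simp [h0] at hdet)
  have hPpos : P.PosDef := by
    rw [hP]
    have h := (PosDef.one (n := (Fin nA ⊕ Fin nB) ⊕ (Fin nA ⊕ Fin nB)) (R := ℝ)).mul_mul_conjTranspose_same
      (B := S) (Matrix.vecMul_injective_of_isUnit hS)
    rw [Matrix.mul_one, conjTranspose_eq_transpose_of_trivial] at h
    exact h.inv
  have hPdet : P.det = 1 := by
    rw [hP, det_nonsing_inv, det_mul, det_transpose, ← pow_two, hdet, Ring.inverse_one]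
  have hW : ∀ z, wigner ħ ψ z = (phaseGaussian ħ P (Φ t z₀) z : ℂ) := fun z => by
    rw [hψ, hP]
    exact wigner_semiclassicalPropagator hħ hV (γ t) (Φ t z₀) z₀ z
  have hψ1 : ‖ψ‖ = 1 := by
    rw [hψ, norm_semiclassicalPropagator, norm_coherentState]
  subst hM
  refine ⟨posDef_blockBB hPpos, posDef_schurA hPpos, fun zA => ?_,
    exists_reducedState hħ hPpos hPdet (Φ t z₀) ψ hψ1 hW⟩
  simp only [hW]
  exact ⟨(integrable_phaseGaussian_joinAB hħ hPpos (Φ t z₀) zA).ofReal, by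
    rw [integral_complex_ofReal, integral_phaseGaussian_joinAB hħ hPpos]⟩
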